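/- Let $D_1,\dots,D_n$ be $n$ closed disks in the Euclidean plane, where $D_i$ has center $p_i$, radius $r_i\ge 0$ and a real weight $w_i$, and suppose that the centers are in convex position, that is, $p_1,\dots,p_n$ are pairwise distinct and each $p_i$ is a vertex of the convex hull of $\{p_1,\dots,p_n\}$. The disk graph has the vertices $1,\dots,n$, with an edge between distinct $i$ and $j$ exactly when $D_i\cap D_j\neq\emptyset$. A dominating set is a set $S$ of vertices such that every vertex is in $S$ or adjacent to a vertex in $S$; its weight is $\sum_{i\in S}w_i$. There is an algorithm on the real RAM (unit-cost exact arithmetic $+,-,\times,/$ and comparisons on real numbers, and unit-cost arithmetic on integers of $O(\log n)$ bits, which also serve as memory addresses) that, given the coordinates of the centers, the radii and the weights of any such $n$ disks, in any order, computes a minimum-weight dominating set of their disk graph in $O(n^5\log^2 n)$ time, hence in time polynomial in $n$. -/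

import Mathlib

open Filter Asymptotics

/-! ### Weighted disks, disk graphs and dominating sets -/

/-- The Euclidean plane. -/
abbrev Plane : Type := EuclideanSpace ℝ (Fin 2)

/-- The disk graph of the closed disks with centers `p i` and radii `r i`: two distinct vertices
are adjacent when their disks intersect. -/
def diskGraph {n : ℕ} (p : Fin n → Plane) (r : Fin n → ℝ) : SimpleGraph (Fin n) where
  Adj i j := i ≠ j ∧ (Metric.closedBall (p i) (r i) ∩ Metric.closedBall (p j) (r j)).Nonempty
  symm := ⟨fun _ _ h => ⟨h.1.symm, by rw [Set.inter_comm]; exact h.2⟩⟩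
  loopless := ⟨fun _ h => h.1 rfl⟩

/-- Every vertex is in `S` or adjacent to a vertex of `S`. -/
def IsDominatingSet {V : Type*} (G : SimpleGraph V) (S : Finset V) : Prop :=
  ∀ v, v ∈ S ∨ ∃ u ∈ S, G.Adj v u

/-- `S` is a dominating set of minimum total weight. -/
def IsMinWeightDominatingSet {V : Type*} (G : SimpleGraph V) (w : V → ℝ) (S : Finset V) : Prop :=
  IsDominatingSet G S ∧ ∀ S' : Finset V, IsDominatingSet G S' → ∑ v ∈ S, w v ≤ ∑ v ∈ S', w v

/-! ### A real RAM

Programs are finite pieces of syntax, independent of the input. The memory consists of integer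
variables and integer arrays (whose cells hold words), and of real variables and real arrays
(whose cells hold exact real numbers); variables and arrays are named by natural numbers, so a
program uses only finitely many of them, and arrays are randomly accessible through computed
integer indices. Real numbers can be added, subtracted, multiplied, divided and compared, but not
rounded: information passes from reals to integers only through comparisons. -/

namespace RealRAM

/-- Memory contents. -/
structure State where
  ivar : ℕ → ℕ
  rvar : ℕ → ℝ
  iarr : ℕ → ℕ → ℕ
  rarr : ℕ → ℕ → ℝ

/-- Integer expressions. -/
inductive IExp : Type
  | lit (m : ℕ)
  | var (x : ℕ)
  | get (a : ℕ) (e : IExp)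
  | add (e₁ e₂ : IExp)
  | sub (e₁ e₂ : IExp)
  | mul (e₁ e₂ : IExp)
  | div (e₁ e₂ : IExp)

/-- Value of an integer expression (truncated subtraction, division rounding down). -/
def IExp.eval (s : State) : IExp → ℕ
  | .lit m => m
  | .var x => s.ivar x
  | .get a e => s.iarr a (e.eval s)
  | .add e₁ e₂ => e₁.eval s + e₂.eval s
  | .sub e₁ e₂ => e₁.eval s - e₂.eval s
  | .mul e₁ e₂ => e₁.eval s * e₂.eval s
  | .div e₁ e₂ => e₁.eval s / e₂.eval s

/-- Number of operations needed to evaluate an integer expression. -/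
def IExp.cost : IExp → ℕ
  | .lit _ => 1
  | .var _ => 1
  | .get _ e => 1 + e.cost
  | .add e₁ e₂ => 1 + e₁.cost + e₂.cost
  | .sub e₁ e₂ => 1 + e₁.cost + e₂.cost
  | .mul e₁ e₂ => 1 + e₁.cost + e₂.cost
  | .div e₁ e₂ => 1 + e₁.cost + e₂.cost

/-- Real expressions; `ofInt` converts an integer to a real number. -/
inductive RExp : Type
  | ofInt (e : IExp)
  | var (x : ℕ)
  | get (a : ℕ) (e : IExp)
  | add (e₁ e₂ : RExp)
  | sub (e₁ e₂ : RExp)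
  | mul (e₁ e₂ : RExp)
  | div (e₁ e₂ : RExp)

/-- Value of a real expression (the quotient by zero is zero). -/
noncomputable def RExp.eval (s : State) : RExp → ℝ
  | .ofInt e => (e.eval s : ℝ)
  | .var x => s.rvar x
  | .get a e => s.rarr a (e.eval s)
  | .add e₁ e₂ => e₁.eval s + e₂.eval s
  | .sub e₁ e₂ => e₁.eval s - e₂.eval s
  | .mul e₁ e₂ => e₁.eval s * e₂.eval s
  | .div e₁ e₂ => e₁.eval s / e₂.eval s

/-- Number of operations needed to evaluate a real expression. -/
def RExp.cost : RExp → ℕ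
  | .ofInt e => 1 + e.cost
  | .var _ => 1
  | .get _ e => 1 + e.cost
  | .add e₁ e₂ => 1 + e₁.cost + e₂.cost
  | .sub e₁ e₂ => 1 + e₁.cost + e₂.cost
  | .mul e₁ e₂ => 1 + e₁.cost + e₂.cost
  | .div e₁ e₂ => 1 + e₁.cost + e₂.cost

/-- Tests: comparisons of integers and of reals, and their Boolean combinations. -/
inductive Test : Type
  | ile (e₁ e₂ : IExp)
  | rle (e₁ e₂ : RExp)
  | neg (b : Test)
  | conj (b₁ b₂ : Test)

/-- Outcome of a test. -/
def Test.holds (s : State) : Test → Prop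
  | .ile e₁ e₂ => e₁.eval s ≤ e₂.eval s
  | .rle e₁ e₂ => e₁.eval s ≤ e₂.eval s
  | .neg b => ¬ b.holds s
  | .conj b₁ b₂ => b₁.holds s ∧ b₂.holds s

/-- Number of operations needed to evaluate a test. -/
def Test.cost : Test → ℕ
  | .ile e₁ e₂ => 1 + e₁.cost + e₂.cost
  | .rle e₁ e₂ => 1 + e₁.cost + e₂.cost
  | .neg b => 1 + b.cost
  | .conj b₁ b₂ => 1 + b₁.cost + b₂.cost

/-- Programs. `iset x e` is `x := e` and `iput a k e` is `a[k] := e` for integers; `rset` and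
`rput` do the same for reals; `loop b c` repeats `c` while `b` holds. -/
inductive Prog : Type
  | skip
  | iset (x : ℕ) (e : IExp)
  | iput (a : ℕ) (k e : IExp)
  | rset (x : ℕ) (e : RExp)
  | rput (a : ℕ) (k : IExp) (e : RExp)
  | seq (c₁ c₂ : Prog)
  | ite (b : Test) (c₁ c₂ : Prog)
  | loop (b : Test) (c : Prog)

/-- `Exec M c s t s'`: started in memory `s`, the program `c` halts after `t` steps in memory `s'`,
and never stores an integer larger than `M`. A run that tries to store a larger integer is stuck:
it has no outcome. Every elementary operation counts as one step. -/
inductive Exec (M : ℕ) : Prog → State → ℕ → State → Prop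
  | skip (s : State) : Exec M .skip s 1 s
  | iset (s : State) (x : ℕ) (e : IExp) (h : e.eval s ≤ M) :
      Exec M (.iset x e) s (1 + e.cost)
        { s with ivar := Function.update s.ivar x (e.eval s) }
  | iput (s : State) (a : ℕ) (k e : IExp) (h : e.eval s ≤ M) :
      Exec M (.iput a k e) s (1 + k.cost + e.cost)
        { s with iarr := Function.update s.iarr a
                          (Function.update (s.iarr a) (k.eval s) (e.eval s)) }
  | rset (s : State) (x : ℕ) (e : RExp) :
      Exec M (.rset x e) s (1 + e.cost)
        { s with rvar := Function.update s.rvar x (e.eval s) }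
  | rput (s : State) (a : ℕ) (k : IExp) (e : RExp) :
      Exec M (.rput a k e) s (1 + k.cost + e.cost)
        { s with rarr := Function.update s.rarr a
                          (Function.update (s.rarr a) (k.eval s) (e.eval s)) }
  | seq {c₁ c₂ : Prog} {s s₁ s₂ : State} {t₁ t₂ : ℕ} :
      Exec M c₁ s t₁ s₁ → Exec M c₂ s₁ t₂ s₂ → Exec M (.seq c₁ c₂) s (t₁ + t₂) s₂
  | ite_true {b : Test} {c₁ c₂ : Prog} {s s' : State} {t : ℕ} :
      b.holds s → Exec M c₁ s t s' → Exec M (.ite b c₁ c₂) s (1 + b.cost + t) s'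
  | ite_false {b : Test} {c₁ c₂ : Prog} {s s' : State} {t : ℕ} :
      ¬ b.holds s → Exec M c₂ s t s' → Exec M (.ite b c₁ c₂) s (1 + b.cost + t) s'
  | loop_true {b : Test} {c : Prog} {s s₁ s₂ : State} {t₁ t₂ : ℕ} :
      b.holds s → Exec M c s t₁ s₁ → Exec M (.loop b c) s₁ t₂ s₂ →
      Exec M (.loop b c) s (1 + b.cost + t₁ + t₂) s₂
  | loop_false {b : Test} {c : Prog} {s : State} :
      ¬ b.holds s → Exec M (.loop b c) s (1 + b.cost) s

/-- The array with entries `f 0, …, f (n - 1)`, followed by zeros. -/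
noncomputable def arrayOf {n : ℕ} (f : Fin n → ℝ) (k : ℕ) : ℝ :=
  if h : k < n then f ⟨k, h⟩ else 0

/-- The memory that holds an instance with `n` disks: `n` is in the integer variable `0`, the
coordinates of the centers are in the real arrays `0` and `1`, the radii in the real array `2` and
the weights in the real array `3`; everything else is zero. -/
noncomputable def inputState {n : ℕ} (p : Fin n → Plane) (r w : Fin n → ℝ) : State where
  ivar x := if x = 0 then n else 0
  rvar _ := 0
  iarr _ _ := 0
  rarr a := match a with
    | 0 => arrayOf (fun i => p i 0)
    | 1 => arrayOf (fun i => p i 1)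
    | 2 => arrayOf r
    | 3 => arrayOf w
    | _ => fun _ => 0

/-- The set of vertices that is written, as an indicator vector, in the integer array `0`. -/
def outputSet (n : ℕ) (s : State) : Finset (Fin n) :=
  Finset.univ.filter fun i => s.iarr 0 i ≠ 0

end RealRAM

/-!
A noncrossing structure makes dynamic programming over intervals possible.

Give all vertices of weight at most zero away for free, so that weights may be replaced by their
positive parts (`isMinWeightDominatingSet_of_posPart`). For an inclusion-minimal dominating set
`S`, assign each vertex `v` to a center `s ∈ S` that minimizes the additively weighted distance
`dist (p v) (p s) - r s`. Every vertex is then assigned to a center that dominates it, and every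
center to itself (`exists_nearest_assignment`). Since the diagonals of a convex quadrilateral are
together longer than two opposite sides, exchanging the centers of two crossing chords would
decrease the sum of their weighted distances; hence the chords from the vertices to their centers
do not cross (`nearest_assignment_noncrossing`). A minimum-weight dominating set is therefore found
by optimizing over noncrossing partitions into stars, in the cyclic order of the vertices.

For an interval `i, …, j - 1` of this order and one outer center `c`, which has been paid for
already, let `B i j c` be the least weight of centers inside the interval that together with `c`
dominate it, over noncrossing assignments. Either `i` is assigned to `c`, which leaves
`B (i + 1) j c`, or to a center `d` of the interval. In the latter case let `k - 1` be the last
vertex assigned to `d`; no chord leaves one of the three remaining parts, except to its outer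
center, and the value is `W d + (B (i + 1) d d + B (d + 1) k d + B k j c)`. One outer center is thus
always enough (`IsLowerBound.step`). Conversely, covers of the parts combine to a cover of the whole
(`IsCover.combine`), so that every value in the table is attained by a dominating set, whether or
not it comes from a noncrossing assignment. There are `O(n ^ 3)` entries with `O(n ^ 2)` choices
each, and storing the sets themselves costs `O(n)` more per entry.

The cyclic order is obtained by counting: the rank of a point is the number of points that precede
it counterclockwise around the first center, which is a strict total order because the points are
in convex position (`Before.trans`, `Before.total`). The programs are verified with a Hoare logic
that tracks the number of steps (`Runs`); its rule `Runs.down` handles counting loops. All stored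
words are at most `(n + 1) ^ 3`.
-/

/-! ### Orientation and the quadrilateral inequality -/

/-- Twice the signed area of the triangle `a b c`; it is positive when the triangle is
oriented counterclockwise. -/
def orient (a b c : Plane) : ℝ :=
  (b 0 - a 0) * (c 1 - a 1) - (b 1 - a 1) * (c 0 - a 0)

theorem orient_rotate (a b c : Plane) : orient b c a = orient a b c := by
  unfold orient; ring

/-- In a convex quadrilateral `a b c d`, two opposite sides are together shorter than the
diagonals. -/
theorem dist_add_dist_lt_of_orient_pos {a b c d : Plane} (habc : 0 < orient a b c)
    (habd : 0 < orient a b d) (hacd : 0 < orient a c d) (hbcd : 0 < orient b c d) :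
    dist a d + dist b c < dist a c + dist b d := by
  -- The diagonals meet in the point `x`.
  set t : ℝ := orient a b d / (orient b c d + orient a b d) with ht
  have hs : 0 < orient b c d + orient a b d := by positivity
  have ht0 : 0 < t := by positivity
  have ht1 : t ≤ 1 := by rw [ht, div_le_one hs]; linarith
  set u : ℝ := orient a b c / (orient b c d + orient a b d) with hu
  have hsum : orient a b c + orient a c d = orient b c d + orient a b d := by
    unfold orient; ring
  have hu0 : 0 < u := by positivity
  have hu1 : u ≤ 1 := by rw [hu, div_le_one hs]; linarith
  set x : Plane := AffineMap.lineMap a c t with hx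
  have hx' : x = AffineMap.lineMap b d u := by
    have key : ∀ k : Fin 2, (orient b c d + orient a b d) * (a k)
        + orient a b d * (c k - a k) = (orient b c d + orient a b d) * (b k)
        + orient a b c * (d k - b k) := by
      intro k; fin_cases k <;> (simp [orient]; ring)
    ext k
    have := key k
    simp only [hx, AffineMap.lineMap_apply, vsub_eq_sub, vadd_eq_add, PiLp.add_apply,
      PiLp.smul_apply, PiLp.sub_apply, smul_eq_mul, ht, hu]
    field_simp
    linarith
  have hac : dist a x + dist x c = dist a c :=
    dist_add_dist_eq_iff.2 ⟨t, ⟨ht0.le, ht1⟩, rfl⟩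
  have hbd : dist b x + dist x d = dist b d :=
    dist_add_dist_eq_iff.2 ⟨u, ⟨hu0.le, hu1⟩, hx'.symm⟩
  have hbc := dist_triangle b x c
  have had : dist a d < dist a x + dist x d := by
    refine lt_of_le_of_ne (dist_triangle a x d) fun h => ?_
    obtain ⟨v, -, hv⟩ := dist_add_dist_eq_iff.1 h.symm
    have e : ∀ k, v * (d k - a k) = t * (c k - a k) := by
      intro k
      have := congrArg (fun z : Plane => z k) (hv.trans hx)
      simpa [AffineMap.lineMap_apply] using this
    have : t * orient a c d = 0 := by
      unfold orient
      linear_combination (d 0 - a 0) * e 1 - (d 1 - a 1) * e 0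
    nlinarith
  linarith

/-! ### Points in convex position -/

section ConvexPosition

variable {n : ℕ} {p : Fin n → Plane}

/-- No point of a convex independent family is a convex combination of three others. -/
theorem ConvexIndependent.not_barycenter (hp : ConvexIndependent ℝ p) {a b c d : Fin n}
    {α β γ : ℝ} (hα : 0 ≤ α) (hβ : 0 ≤ β) (hγ : 0 ≤ γ) (hs : 0 < α + β + γ)
    (h : ∀ k, α * p a k + β * p b k + γ * p c k = (α + β + γ) * p d k) :
    d = a ∨ d = b ∨ d = c := by
  have hd : p d = (α / (α + β + γ)) • p a + (β / (α + β + γ)) • p b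
      + (γ / (α + β + γ)) • p c := by
    ext k
    have := h k
    simp only [PiLp.add_apply, PiLp.smul_apply, smul_eq_mul]
    field_simp
    linarith
  have hmem : p d ∈ convexHull ℝ (p '' {a, b, c}) := by
    rw [hd]
    refine (convex_convexHull ℝ (p '' {a, b, c})).sum_mem (t := Finset.univ)
      (w := ![α / (α + β + γ), β / (α + β + γ), γ / (α + β + γ)])
      (z := ![p a, p b, p c]) ?_ ?_ ?_ |> fun h => by simpa [Fin.sum_univ_three] using h
    · intro i _; fin_cases i <;> (simp; positivity)
    · simp [Fin.sum_univ_three]; field_simp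
    · intro i _; apply subset_convexHull; fin_cases i <;> simp
  simpa using hp _ _ hmem

/-- Three points of a family in convex position are not collinear. -/
theorem ConvexIndependent.orient_ne_zero (hp : ConvexIndependent ℝ p) {o a b : Fin n}
    (hoa : a ≠ o) (hob : b ≠ o) (hab : a ≠ b) : orient (p o) (p a) (p b) ≠ 0 := by
  intro h
  set u : Fin 2 → ℝ := fun k => p a k - p o k with hu
  set v : Fin 2 → ℝ := fun k => p b k - p o k with hv
  have huv : u 0 * v 1 - u 1 * v 0 = 0 := h
  set q := u 0 * u 0 + u 1 * u 1 with hq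
  set s := u 0 * v 0 + u 1 * v 1 with hs
  have hq0 : 0 < q := by
    by_contra hneg
    have h0 : u 0 = 0 := by nlinarith [mul_self_nonneg (u 0), mul_self_nonneg (u 1)]
    have h1 : u 1 = 0 := by nlinarith [mul_self_nonneg (u 0), mul_self_nonneg (u 1)]
    refine hoa (hp.injective ?_)
    ext k
    fin_cases k
    · simpa [hu, sub_eq_zero] using h0
    · simpa [hu, sub_eq_zero] using h1
  have key : ∀ k, q * v k = s * u k := by
    intro k
    fin_cases k
    · simp only [hq, hs, Fin.zero_eta]; linear_combination u 1 * huv * (-1)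
    · simp only [hq, hs, Fin.mk_one]; linear_combination u 0 * huv
  have hk : ∀ k, q * (p b k - p o k) = s * (p a k - p o k) := key
  rcases le_or_gt s 0 with hs0 | hs0
  · rcases hp.not_barycenter (a := b) (b := a) (c := a) (d := o) hq0.le
      (neg_nonneg.2 hs0) le_rfl (by linarith) (fun k => by linear_combination hk k) with
      h | h | h
    · exact hob h.symm
    · exact hoa h.symm
    · exact hoa h.symm
  · rcases le_or_gt s q with hsq | hsq
    · rcases hp.not_barycenter (a := a) (b := o) (c := o) (d := b) hs0.le
        (sub_nonneg.2 hsq) le_rfl (by linarith) (fun k => by linear_combination - hk k) with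
        h | h | h
      · exact hab h.symm
      · exact hob h
      · exact hob h
    · rcases hp.not_barycenter (a := b) (b := o) (c := o) (d := a) hq0.le
        (sub_nonneg.2 hsq.le) le_rfl (by linarith) (fun k => by linear_combination hk k) with
        h | h | h
      · exact hab h
      · exact hoa h
      · exact hoa h

/-- Seen from `p o`, the points come in counterclockwise order; `o` itself comes first. -/
def Before (p : Fin n → Plane) (o a b : Fin n) : Prop :=
  (a = o ∧ b ≠ o) ∨ (a ≠ o ∧ 0 < orient (p o) (p a) (p b))

theorem orient_self_right (a b : Plane) : orient a b a = 0 := by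
  unfold orient; ring

theorem orient_self_left (a b : Plane) : orient a a b = 0 := by
  unfold orient; ring

theorem orient_self_mid (a b : Plane) : orient a b b = 0 := by
  unfold orient; ring

theorem Before.ne {o a b : Fin n} (h : Before p o a b) : b ≠ o := by
  rcases h with ⟨-, h⟩ | ⟨-, h⟩
  · exact h
  · rintro rfl; rw [orient_self_right] at h; exact lt_irrefl _ h

theorem Before.irrefl (o a : Fin n) : ¬ Before p o a a := by
  rintro (⟨h, h'⟩ | ⟨-, h⟩)
  · exact h' h
  · rw [orient_self_mid] at h; exact lt_irrefl _ h

/-- A failure of transitivity would put `p o` into the convex hull of three other points. -/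
theorem Before.trans (hp : ConvexIndependent ℝ p) {o a b c : Fin n}
    (hab : Before p o a b) (hbc : Before p o b c) : Before p o a c := by
  have hb := hab.ne
  have hc := hbc.ne
  rcases hab with ⟨ha, -⟩ | ⟨ha, hab⟩
  · exact .inl ⟨ha, hc⟩
  rcases hbc with ⟨hb', -⟩ | ⟨-, hbc⟩
  · exact absurd hb' hb
  refine .inr ⟨ha, ?_⟩
  by_contra hneg
  rcases hp.not_barycenter (a := a) (b := b) (c := c) (d := o) hbc.le
    (neg_nonneg.2 (not_lt.1 hneg)) hab.le (by linarith [not_lt.1 hneg])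
    (fun k => by fin_cases k <;> (simp [orient]; ring)) with h | h | h
  · exact ha h.symm
  · exact hb h.symm
  · exact hc h.symm

theorem Before.total (hp : ConvexIndependent ℝ p) {o a b : Fin n} (hab : a ≠ b) :
    Before p o a b ∨ Before p o b a := by
  by_cases ha : a = o
  · exact .inl (.inl ⟨ha, fun h => hab (ha.trans h.symm)⟩)
  by_cases hb : b = o
  · exact .inr (.inl ⟨hb, ha⟩)
  rcases lt_or_gt_of_ne (hp.orient_ne_zero ha hb hab) with h | h
  · refine .inr (.inr ⟨hb, ?_⟩)
    have : orient (p o) (p b) (p a) = - orient (p o) (p a) (p b) := by unfold orient; ring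
    linarith
  · exact .inl (.inr ⟨ha, h⟩)

/-- The order around `p o` is the cyclic order: every triple taken in this order turns left. -/
theorem Before.orient_pos (hp : ConvexIndependent ℝ p) {o a b c : Fin n}
    (hab : Before p o a b) (hbc : Before p o b c) : 0 < orient (p a) (p b) (p c) := by
  have hac := hab.trans hp hbc
  have hb := hab.ne
  have hc := hbc.ne
  have hbc0 := hbc
  rcases hbc with ⟨hb', -⟩ | ⟨-, hbc⟩
  · exact absurd hb' hb
  rcases hab with ⟨rfl, -⟩ | ⟨ha, hab'⟩
  · exact hbc
  rcases hac with ⟨ha', -⟩ | ⟨-, hac⟩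
  · exact absurd ha' ha
  -- Otherwise `p b` would lie in the triangle spanned by `p o`, `p a` and `p c`.
  by_contra hneg
  have hsum : - orient (p a) (p b) (p c) + orient (p o) (p b) (p c)
      + orient (p o) (p a) (p b) = orient (p o) (p a) (p c) := by unfold orient; ring
  rcases hp.not_barycenter (a := o) (b := a) (c := c) (d := b)
    (neg_nonneg.2 (not_lt.1 hneg)) hbc.le hab'.le (by rw [hsum]; exact hac)
    (fun k => by fin_cases k <;> (simp [orient]; ring)) with h | h | h
  · exact hb h
  · subst h; rw [orient_self_mid] at hab'; exact lt_irrefl _ hab'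
  · subst h; rw [orient_self_mid] at hbc; exact lt_irrefl _ hbc

open Classical in
/-- The position of `a` in the counterclockwise order around `p o`. -/
noncomputable def rank (p : Fin n → Plane) (o a : Fin n) : ℕ :=
  (Finset.univ.filter fun b => Before p o b a).card

theorem rank_lt (o a : Fin n) : rank p o a < n := by
  classical
  have : (Finset.univ.filter fun b => Before p o b a) ⊂ Finset.univ := by
    refine Finset.filter_ssubset.2 ⟨a, Finset.mem_univ _, Before.irrefl o a⟩
  simpa [rank] using Finset.card_lt_card this

theorem rank_lt_rank (hp : ConvexIndependent ℝ p) {o a b : Fin n} (h : Before p o a b) :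
    rank p o a < rank p o b := by
  classical
  refine Finset.card_lt_card ⟨fun c hc => ?_, fun hsub => ?_⟩
  · simp only [Finset.mem_filter, Finset.mem_univ, true_and] at hc ⊢
    exact hc.trans hp h
  · have := hsub (show a ∈ _ from by simpa using h)
    simp only [Finset.mem_filter, Finset.mem_univ, true_and] at this
    exact Before.irrefl o a this

theorem before_of_rank_lt (hp : ConvexIndependent ℝ p) {o a b : Fin n}
    (h : rank p o a < rank p o b) : Before p o a b := by
  rcases eq_or_ne a b with rfl | hab
  · exact absurd h (lt_irrefl _)
  · exact (Before.total hp hab).resolve_right fun h' => lt_asymm h (rank_lt_rank hp h')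

theorem rank_injective (hp : ConvexIndependent ℝ p) (o : Fin n) :
    Function.Injective (rank p o) := by
  intro a b hab
  by_contra hne
  rcases Before.total hp (o := o) hne with h | h
  · exact absurd hab (rank_lt_rank hp h).ne
  · exact absurd hab (rank_lt_rank hp h).ne'

/-- The rank of a point as the sorting phase counts it. -/
theorem rank_eq (o a : Fin n) [DecidablePred fun b => 0 < orient (p o) (p b) (p a)] :
    rank p o a = (if a = o then 0 else 1)
      + (Finset.univ.filter fun b => 0 < orient (p o) (p b) (p a)).card := by
  classical
  unfold rank
  split_ifs with h
  · subst h
    rw [zero_add]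
    congr 1
    ext b
    simp [Before, orient_self_right]
  · rw [add_comm, ← Finset.card_insert_of_notMem (a := o)]
    · congr 1
      ext b
      rw [Finset.mem_insert, Finset.mem_filter, Finset.mem_filter]
      by_cases hb : b = o
      · simp [Before, hb, h]
      · simp [Before, hb]
    · simp [orient_self_left]

/-- In the order around `p o`, the diagonals of a quadrilateral are together longer than either
pair of opposite sides. -/
theorem dist_add_dist_lt_of_rank_lt (hp : ConvexIndependent ℝ p) {o a b c d : Fin n}
    (hab : rank p o a < rank p o b) (hbc : rank p o b < rank p o c)
    (hcd : rank p o c < rank p o d) :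
    dist (p a) (p d) + dist (p b) (p c) < dist (p a) (p c) + dist (p b) (p d) ∧
      dist (p a) (p b) + dist (p c) (p d) < dist (p a) (p c) + dist (p b) (p d) := by
  have hab := before_of_rank_lt hp hab
  have hbc := before_of_rank_lt hp hbc
  have hcd := before_of_rank_lt hp hcd
  have h1 := hab.orient_pos hp hbc
  have h2 := hab.orient_pos hp (hbc.trans hp hcd)
  have h3 := (hab.trans hp hbc).orient_pos hp hcd
  have h4 := hbc.orient_pos hp hcd
  refine ⟨dist_add_dist_lt_of_orient_pos h1 h2 h3 h4, ?_⟩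
  have h := dist_add_dist_lt_of_orient_pos (a := p b) (b := p c) (c := p d) (d := p a) h4
    (by rwa [orient_rotate]) (by rwa [orient_rotate]) (by rwa [orient_rotate])
  rw [dist_comm (p b) (p a), dist_comm (p c) (p a)] at h
  linarith

end ConvexPosition

/-! ### Noncrossing assignments and the interval recursion -/

/-- An assignment `f` of the vertices `0, …, n - 1` to dominating centers, where `N v u` says that
`u` dominates `v`: centers are fixed, and the chords from the vertices to their centers do not
cross when the vertices are placed on a circle in their natural order. -/
structure IsNoncrossing (n : ℕ) (N : ℕ → ℕ → Prop) (f : ℕ → ℕ) : Prop where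
  lt : ∀ v < n, f v < n
  dom : ∀ v < n, N v (f v)
  idem : ∀ v < n, f (f v) = f v
  cross : ∀ a b c d, a < b → b < c → c < d → d < n →
    (f a = c ∨ f c = a) → (f b = d ∨ f d = b) → False

/-- `x` bounds from below the weight of the centers between `i` and `j - 1` of every noncrossing
assignment in which the vertices `i, …, j - 1` are assigned to one another or to the outer
center `c`. The value `c = n` means that there is no outer center. -/
def IsLowerBound (n : ℕ) (N : ℕ → ℕ → Prop) (W : ℕ → ℝ) (i j c : ℕ) (x : ℝ) : Prop :=
  ∀ f, IsNoncrossing n N f → (c < i ∨ j ≤ c) →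
    (∀ v, i ≤ v → v < j → (i ≤ f v ∧ f v < j) ∨ f v = c) →
    x ≤ ∑ v ∈ Finset.Ico i j, if f v = v then W v else 0

open Classical in
/-- The set `U`, of weight at most `x`, dominates all of `i, …, j - 1` that the outer center `c`
does not dominate. The value `c = n` means that there is no outer center. -/
def IsCover (n : ℕ) (N : ℕ → ℕ → Prop) (W : ℕ → ℝ) (U : ℕ → Prop) (i j c : ℕ) (x : ℝ) : Prop :=
  (∀ v, i ≤ v → v < j → (∃ u < n, U u ∧ N v u) ∨ (c < n ∧ N v c)) ∧
    ∑ u ∈ Finset.range n, (if U u then W u else 0) ≤ x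

section Recursion

variable {n : ℕ} {N : ℕ → ℕ → Prop} {W : ℕ → ℝ}

theorem IsLowerBound.of_le {i j c : ℕ} (h : j ≤ i) : IsLowerBound n N W i j c 0 := by
  intro f _ _ _
  rw [Finset.Ico_eq_empty (by omega)]
  simp

theorem IsCover.of_le {U : ℕ → Prop} {i j c : ℕ} (h : j ≤ i) (hU : ∀ u < n, ¬ U u) :
    IsCover n N W U i j c 0 := by
  refine ⟨fun v _ _ => by omega, le_of_eq (Finset.sum_eq_zero fun u hu => ?_)⟩
  rw [if_neg (hU u (Finset.mem_range.1 hu))]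

/-- The recursion for the optimal values. In a noncrossing assignment of `i, …, j - 1`, the vertex
`i` is assigned either to the outer center `c` or to some `d`; in the latter case, if `k - 1` is
the last vertex assigned to `d`, no chord connects two of the parts `i + 1, …, d - 1`,
`d + 1, …, k - 1` and `k, …, j - 1`, whose outer centers are `d`, `d` and `c`. -/
theorem IsLowerBound.step {V : ℕ → ℕ → ℕ → ℝ} {i j c : ℕ} {x : ℝ}
    (hij : i < j) (hj : j ≤ n) (hc : c ≤ n)
    (hV : ∀ i' j' c', i < i' → i' ≤ n → j' ≤ n → c' ≤ n →
      IsLowerBound n N W i' j' c' (V i' j' c'))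
    (hx : c < n → N i c → x ≤ V (i + 1) j c)
    (hd : ∀ d k, i ≤ d → d < k → k ≤ j → N i d →
      x ≤ W d + (V (i + 1) d d + V (d + 1) k d + V k j c)) :
    IsLowerBound n N W i j c x := by
  intro f hf hcij hcl
  rcases hcl i le_rfl hij with ⟨hd1, hd2⟩ | hic
  · -- Vertex `i` is assigned to the center `d := f i` inside the interval.
    obtain ⟨d, hdef⟩ : ∃ d, f i = d := ⟨_, rfl⟩
    rw [hdef] at hd1 hd2
    have hfd : f d = d := by rw [← hdef]; exact hf.idem i (by omega)
    obtain ⟨m, hm1, hm2, hm3, hm4⟩ : ∃ m, d ≤ m ∧ m < j ∧ f m = d ∧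
        ∀ v, m < v → v < j → f v ≠ d := by
      classical
      have hne : ((Finset.Ico d j).filter fun v => f v = d).Nonempty :=
        ⟨d, by simp [hfd, hd2]⟩
      have hmem := Finset.max'_mem _ hne
      refine ⟨((Finset.Ico d j).filter fun v => f v = d).max' hne, ?_, ?_, ?_,
        fun v hv1 hv2 hv3 => ?_⟩
      · exact (Finset.mem_Ico.1 (Finset.mem_filter.1 hmem).1).1
      · exact (Finset.mem_Ico.1 (Finset.mem_filter.1 hmem).1).2
      · exact (Finset.mem_filter.1 hmem).2
      · have hdm := (Finset.mem_Ico.1 (Finset.mem_filter.1 hmem).1).1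
        refine absurd (Finset.le_max' ((Finset.Ico d j).filter fun v => f v = d) v ?_)
          (not_le.2 hv1)
        simp only [Finset.mem_filter, Finset.mem_Ico]
        exact ⟨⟨by omega, hv2⟩, hv3⟩
    have hN : N i d := hdef ▸ hf.dom i (by omega)
    have hle := hd d (m + 1) hd1 (by omega) (by omega) hN
    -- The three parts are closed under the assignment.
    have h1 := hV (i + 1) d d (by omega) (by omega) (by omega) (by omega) f hf (by omega) <| by
      intro v hv1 hv2
      have hvn := hf.lt v (by omega)
      rcases eq_or_ne (f v) d with h | h
      · exact .inr h
      refine .inl ⟨?_, ?_⟩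
      · by_contra hlt
        rcases lt_or_ge (f v) i with h' | h'
        · exact hf.cross (f v) i v d h' (by omega) hv2 (by omega) (.inr rfl) (.inl hdef)
        · have hvi : f v = i := by omega
          have := hf.idem v (by omega)
          rw [hvi, hdef] at this
          omega
      · by_contra hlt
        exact hf.cross i v d (f v) (by omega) hv2 (by omega) hvn (.inl hdef) (.inl rfl)
    have h2 := hV (d + 1) (m + 1) d (by omega) (by omega) (by omega) (by omega) f hf
        (by omega) <| by
      intro v hv1 hv2
      have hvn := hf.lt v (by omega)
      rcases eq_or_ne (f v) d with h | h
      · exact .inr h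
      have hvm : v < m := by
        rcases eq_or_ne v m with rfl | h'
        · exact absurd hm3 h
        · omega
      refine .inl ⟨?_, ?_⟩
      · by_contra hlt
        exact hf.cross (f v) d v m (by omega) (by omega) hvm (by omega) (.inr rfl) (.inr hm3)
      · by_contra hlt
        exact hf.cross d v m (f v) (by omega) hvm (by omega) hvn (.inr hm3) (.inl rfl)
    have h3 := hV (m + 1) j c (by omega) (by omega) (by omega) (by omega) f hf (by omega) <| by
      intro v hv1 hv2
      rcases hcl v (by omega) hv2 with ⟨h, h'⟩ | h
      swap
      · exact .inr h
      refine .inl ⟨?_, h'⟩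
      by_contra hlt
      have hvd := hm4 v (by omega) hv2
      have hvi := hf.idem v (by omega)
      rcases eq_or_ne (f v) m with h'' | h''
      · rw [h'', hm3] at hvi
        exact hvd (by omega)
      rcases eq_or_ne (f v) i with h3 | h3
      · rw [h3, hdef] at hvi
        exact hvd (by omega)
      rcases lt_or_gt_of_ne hvd with h4 | h4
      · exact hf.cross i (f v) d v (by omega) h4 (by omega) (by omega) (.inl hdef) (.inr rfl)
      · exact hf.cross d (f v) m v h4 (by omega) (by omega) (by omega) (.inr hm3) (.inr rfl)
    refine hle.trans ?_
    set g : ℕ → ℝ := fun v => if f v = v then W v else 0 with hg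
    have e1 : ∑ v ∈ Finset.Ico i d, g v = ∑ v ∈ Finset.Ico (i + 1) d, g v := by
      rcases eq_or_lt_of_le hd1 with rfl | h
      · simp
      · rw [Finset.sum_eq_sum_Ico_succ_bot h]
        have : g i = 0 := by simp only [hg]; rw [if_neg (by omega)]
        rw [this, zero_add]
    have e2 : g d = W d := by simp only [hg]; rw [if_pos hfd]
    have e3 := Finset.sum_Ico_consecutive g hd1 hd2.le
    have e4 := Finset.sum_eq_sum_Ico_succ_bot hd2 g
    have e5 := Finset.sum_Ico_consecutive g (show d + 1 ≤ m + 1 by omega)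
      (show m + 1 ≤ j by omega)
    linarith
  · -- Vertex `i` is assigned to the outer center.
    have hfi := hf.lt i (by omega)
    refine (hx (by omega) (hic ▸ hf.dom i (by omega))).trans ?_
    have h1 := hV (i + 1) j c (by omega) (by omega) hj hc f hf (by omega) <| by
      intro v hv1 hv2
      rcases hcl v (by omega) hv2 with ⟨h, h'⟩ | h
      swap
      · exact .inr h
      refine .inl ⟨?_, h'⟩
      by_contra hlt
      have hvi : f v = i := by omega
      have := hf.idem v (by omega)
      rw [hvi, hic] at this
      omega
    rw [Finset.sum_eq_sum_Ico_succ_bot hij, if_neg (by omega), zero_add]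
    exact h1

theorem sum_ite_or_le (hW : ∀ u, 0 ≤ W u) (s : Finset ℕ) (P Q : ℕ → Prop)
    [DecidablePred P] [DecidablePred Q] [DecidablePred fun u => P u ∨ Q u] :
    ∑ u ∈ s, (if P u ∨ Q u then W u else 0) ≤
      ∑ u ∈ s, (if P u then W u else 0) + ∑ u ∈ s, (if Q u then W u else 0) := by
  rw [← Finset.sum_add_distrib]
  refine Finset.sum_le_sum fun u _ => ?_
  have := hW u
  by_cases hP : P u <;> by_cases hQ : Q u <;> simp [hP, hQ, this]

/-- A cover of an interval, assembled along the recursion from covers of the three parts and the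
center `d`. -/
theorem IsCover.combine (hW : ∀ u, 0 ≤ W u) {U₁ U₂ U₃ : ℕ → Prop} {i j c d k : ℕ}
    {x₁ x₂ x₃ : ℝ} (hid : i ≤ d) (hdk : d < k) (hdn : d < n) (hN : N i d) (hNd : N d d)
    (h₁ : IsCover n N W U₁ (i + 1) d d x₁) (h₂ : IsCover n N W U₂ (d + 1) k d x₂)
    (h₃ : IsCover n N W U₃ k j c x₃) :
    IsCover n N W (fun u => U₁ u ∨ U₂ u ∨ U₃ u ∨ u = d) i j c (W d + (x₁ + x₂ + x₃)) := by
  classical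
  have hd : ∀ v, N v d → ∃ u < n, (U₁ u ∨ U₂ u ∨ U₃ u ∨ u = d) ∧ N v u :=
    fun v hv => ⟨d, hdn, .inr (.inr (.inr rfl)), hv⟩
  refine ⟨fun v hv1 hv2 => ?_, ?_⟩
  · rcases eq_or_ne v i with rfl | hvi
    · exact .inl (hd v hN)
    rcases lt_trichotomy v d with h | rfl | h
    · rcases h₁.1 v (by omega) h with ⟨u, hu, hU, hvu⟩ | ⟨-, h⟩
      · exact .inl ⟨u, hu, .inl hU, hvu⟩
      · exact .inl (hd v h)
    · exact .inl (hd v hNd)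
    · rcases lt_or_ge v k with h' | h'
      · rcases h₂.1 v (by omega) h' with ⟨u, hu, hU, hvu⟩ | ⟨-, h⟩
        · exact .inl ⟨u, hu, .inr (.inl hU), hvu⟩
        · exact .inl (hd v h)
      · rcases h₃.1 v h' hv2 with ⟨u, hu, hU, hvu⟩ | h
        · exact .inl ⟨u, hu, .inr (.inr (.inl hU)), hvu⟩
        · exact .inr h
  · have e1 := sum_ite_or_le hW (Finset.range n) U₁ (fun u => U₂ u ∨ U₃ u ∨ u = d)
    have e2 := sum_ite_or_le hW (Finset.range n) U₂ (fun u => U₃ u ∨ u = d)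
    have e3 := sum_ite_or_le hW (Finset.range n) U₃ (fun u => u = d)
    have e4 : ∑ u ∈ Finset.range n, (if u = d then W u else 0) = W d := by
      simp [hdn]
    have := h₁.2
    have := h₂.2
    have := h₃.2
    refine le_trans (le_of_eq (Finset.sum_congr rfl fun u _ => by congr)) (e1.trans ?_)
    linarith

/-- The first vertex of an interval may be its own center. -/
theorem IsCover.self (hW : ∀ u, 0 ≤ W u) {U : ℕ → Prop} {i j c : ℕ} {x : ℝ} (hin : i < n)
    (hN : N i i) (h : IsCover n N W U (i + 1) j c x) :
    IsCover n N W (fun u => U u ∨ U u ∨ U u ∨ u = i) i j c (W i + x) := by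
  classical
  have h0 : ∀ a b, b ≤ a → IsCover n N W (fun _ => False) a b i 0 :=
    fun a b hab => .of_le hab fun _ _ h => h
  have := IsCover.combine hW le_rfl (Nat.lt_succ_self i) hin hN hN (h0 _ _ (Nat.le_succ i))
    (h0 _ _ le_rfl) h
  simpa using this

/-- The first vertex of an interval may be dominated by the outer center. -/
theorem IsCover.outer {U : ℕ → Prop} {i j c : ℕ} {x : ℝ} (hcn : c < n)
    (hN : N i c) (h : IsCover n N W U (i + 1) j c x) :
    IsCover n N W (fun u => U u ∨ U u ∨ U u ∨ u = n) i j c x := by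
  classical
  refine ⟨fun v hv1 hv2 => ?_, ?_⟩
  · rcases eq_or_ne v i with rfl | hvi
    · exact .inr ⟨hcn, hN⟩
    rcases h.1 v (by omega) hv2 with ⟨u, hu, hU, hvu⟩ | h
    · exact .inl ⟨u, hu, .inl hU, hvu⟩
    · exact .inr h
  · refine le_trans (le_of_eq (Finset.sum_congr rfl fun u hu => ?_)) h.2
    have : u ≠ n := (Finset.mem_range.1 hu).ne
    simp [this]

theorem IsCover.congr {U U' : ℕ → Prop} {i j c : ℕ} {x : ℝ} (h : IsCover n N W U i j c x)
    (hU : ∀ u < n, U' u ↔ U u) : IsCover n N W U' i j c x := by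
  classical
  refine ⟨fun v hv1 hv2 => ?_, ?_⟩
  · rcases h.1 v hv1 hv2 with ⟨u, hu, hU', hvu⟩ | h
    · exact .inl ⟨u, hu, (hU u hu).2 hU', hvu⟩
    · exact .inr h
  · refine le_trans (le_of_eq (Finset.sum_congr rfl fun u hu => ?_)) h.2
    simp [hU u (Finset.mem_range.1 hu)]

end Recursion

/-! ### Reasoning about programs -/

namespace RealRAM

/-- The memory after the assignment of `v` to the integer variable `x`. -/
def State.setI (s : State) (x v : ℕ) : State :=
  { s with ivar := Function.update s.ivar x v }

/-- The memory after the assignment of `v` to the real variable `x`. -/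
noncomputable def State.setR (s : State) (x : ℕ) (v : ℝ) : State :=
  { s with rvar := Function.update s.rvar x v }

/-- The memory after the assignment of `v` to the cell `k` of the integer array `a`. -/
def State.putI (s : State) (a k v : ℕ) : State :=
  { s with iarr := Function.update s.iarr a (Function.update (s.iarr a) k v) }

/-- The memory after the assignment of `v` to the cell `k` of the real array `a`. -/
noncomputable def State.putR (s : State) (a k : ℕ) (v : ℝ) : State :=
  { s with rarr := Function.update s.rarr a (Function.update (s.rarr a) k v) }

section Access

variable (s : State) (x y a b k l v : ℕ) (z : ℝ)

@[simp] theorem State.setI_ivar : (s.setI x v).ivar y = if y = x then v else s.ivar y :=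
  Function.update_apply ..
@[simp] theorem State.setI_rvar : (s.setI x v).rvar = s.rvar := rfl
@[simp] theorem State.setI_iarr : (s.setI x v).iarr = s.iarr := rfl
@[simp] theorem State.setI_rarr : (s.setI x v).rarr = s.rarr := rfl

@[simp] theorem State.setR_ivar : (s.setR x z).ivar = s.ivar := rfl
@[simp] theorem State.setR_rvar : (s.setR x z).rvar y = if y = x then z else s.rvar y :=
  Function.update_apply ..
@[simp] theorem State.setR_iarr : (s.setR x z).iarr = s.iarr := rfl
@[simp] theorem State.setR_rarr : (s.setR x z).rarr = s.rarr := rfl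

@[simp] theorem State.putI_ivar : (s.putI a k v).ivar = s.ivar := rfl
@[simp] theorem State.putI_iarr :
    (s.putI a k v).iarr b l = if b = a ∧ l = k then v else s.iarr b l := by
  by_cases hb : b = a
  · subst hb
    by_cases hl : l = k <;> simp [State.putI, hl]
  · simp [State.putI, hb]
@[simp] theorem State.putI_rarr : (s.putI a k v).rarr = s.rarr := rfl

@[simp] theorem State.putR_ivar : (s.putR a k z).ivar = s.ivar := rfl
@[simp] theorem State.putR_iarr : (s.putR a k z).iarr = s.iarr := rfl
@[simp] theorem State.putR_rarr :
    (s.putR a k z).rarr b l = if b = a ∧ l = k then z else s.rarr b l := by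
  by_cases hb : b = a
  · subst hb
    by_cases hl : l = k <;> simp [State.putR, hl]
  · simp [State.putR, hb]

end Access

/-- Started in `s`, the program `c` halts within `t` steps, with words bounded by `M`, in a memory
that satisfies `Q`. -/
def Runs (M : ℕ) (c : Prog) (s : State) (t : ℕ) (Q : State → Prop) : Prop :=
  ∃ t' ≤ t, ∃ s', Exec M c s t' s' ∧ Q s'

section Rules

variable {M t : ℕ} {s : State} {Q : State → Prop}

theorem Runs.mono {c : Prog} {t₀ : ℕ} {Q₀ : State → Prop} (h : Runs M c s t₀ Q₀) (ht : t₀ ≤ t)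
    (hQ : ∀ s', Q₀ s' → Q s') : Runs M c s t Q := by
  obtain ⟨t', h1, s', h2, h3⟩ := h
  exact ⟨t', h1.trans ht, s', h2, hQ _ h3⟩

theorem Runs.skip (ht : 1 ≤ t) (h : Q s) : Runs M .skip s t Q :=
  ⟨1, ht, s, .skip s, h⟩

theorem Runs.iset {x : ℕ} {e : IExp} (hM : e.eval s ≤ M) (ht : 1 + e.cost ≤ t)
    (h : Q (s.setI x (e.eval s))) : Runs M (.iset x e) s t Q :=
  ⟨_, ht, _, .iset s x e hM, h⟩

theorem Runs.iput {a : ℕ} {k e : IExp} (hM : e.eval s ≤ M) (ht : 1 + k.cost + e.cost ≤ t)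
    (h : Q (s.putI a (k.eval s) (e.eval s))) : Runs M (.iput a k e) s t Q :=
  ⟨_, ht, _, .iput s a k e hM, h⟩

theorem Runs.rset {x : ℕ} {e : RExp} (ht : 1 + e.cost ≤ t)
    (h : Q (s.setR x (e.eval s))) : Runs M (.rset x e) s t Q :=
  ⟨_, ht, _, .rset s x e, h⟩

theorem Runs.rput {a : ℕ} {k : IExp} {e : RExp} (ht : 1 + k.cost + e.cost ≤ t)
    (h : Q (s.putR a (k.eval s) (e.eval s))) : Runs M (.rput a k e) s t Q :=
  ⟨_, ht, _, .rput s a k e, h⟩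

theorem Runs.seq {c₁ c₂ : Prog} {t₁ t₂ : ℕ}
    (h : Runs M c₁ s t₁ fun s₁ => Runs M c₂ s₁ t₂ Q) (ht : t₁ + t₂ ≤ t) :
    Runs M (.seq c₁ c₂) s t Q := by
  obtain ⟨t', h1, s', h2, t'', h3, s'', h4, h5⟩ := h
  exact ⟨t' + t'', by omega, s'', .seq h2 h4, h5⟩

theorem Runs.ite {b : Test} {c₁ c₂ : Prog} {t₀ : ℕ}
    (h₁ : b.holds s → Runs M c₁ s t₀ Q) (h₂ : ¬ b.holds s → Runs M c₂ s t₀ Q)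
    (ht : 1 + b.cost + t₀ ≤ t) : Runs M (.ite b c₁ c₂) s t Q := by
  by_cases hb : b.holds s
  · obtain ⟨t', h1, s', h2, h3⟩ := h₁ hb
    exact ⟨_, by omega, s', .ite_true hb h2, h3⟩
  · obtain ⟨t', h1, s', h2, h3⟩ := h₂ hb
    exact ⟨_, by omega, s', .ite_false hb h2, h3⟩

/-- The loop that runs `c` for `x = m - 1, …, 1, 0`, where `m` is the value of `e`. -/
def Prog.down (x : ℕ) (e : IExp) (c : Prog) : Prog :=
  .seq (.iset x e) (.loop (.ile (.lit 1) (.var x)) (.seq (.iset x (.sub (.var x) (.lit 1))) c))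

/-- `I k` is the loop invariant that holds when the rounds with `x ≥ k` have been completed. -/
theorem Runs.down {x : ℕ} {e : IExp} {c : Prog} {m t₀ : ℕ} (I : ℕ → State → Prop)
    (hm : e.eval s = m) (hM : m ≤ M) (h0 : I m (s.setI x m))
    (hstep : ∀ k s, k < m → I (k + 1) s → s.ivar x = k + 1 →
      Runs M c (s.setI x k) t₀ fun s' => I k s' ∧ s'.ivar x = k)
    (hQ : ∀ s', I 0 s' → Q s') (ht : 5 + e.cost + m * (8 + t₀) ≤ t) :
    Runs M (.down x e c) s t Q := by
  have loop : ∀ k s, k ≤ m → I k s → s.ivar x = k →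
      Runs M (.loop (.ile (.lit 1) (.var x)) (.seq (.iset x (.sub (.var x) (.lit 1))) c)) s
        (4 + k * (8 + t₀)) Q := by
    intro k
    induction k with
    | zero =>
      intro s _ hI hx
      exact ⟨4, by omega, s, .loop_false (by simp [Test.holds, IExp.eval, hx]), hQ _ hI⟩
    | succ k ih =>
      intro s hk hI hx
      obtain ⟨t₁, ht₁, s₁, he, hI', hx'⟩ := hstep k s (by omega) hI hx
      obtain ⟨t₂, ht₂, s₂, he', hq⟩ := ih s₁ (by omega) hI' hx'
      have e1 : (IExp.sub (.var x) (.lit 1)).eval s = k := by simp [IExp.eval, hx]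
      have he1 : Exec M (.iset x (.sub (.var x) (.lit 1))) s 4 (s.setI x k) := by
        have := Exec.iset (M := M) s x (.sub (.var x) (.lit 1)) (by omega)
        rw [e1] at this
        exact this
      refine ⟨_, ?_, s₂, .loop_true (by simp [Test.holds, IExp.eval, hx]) (.seq he1 he) he', hq⟩
      simp only [Test.cost, IExp.cost]
      nlinarith
  refine Runs.seq (t₁ := 1 + e.cost) (t₂ := 4 + m * (8 + t₀)) ?_ (by omega)
  refine Runs.iset (by omega) le_rfl ?_
  rw [hm]
  exact loop m _ le_rfl h0 (by simp)

end Rules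

end RealRAM

/-! ### Sorting the centers and clamping the weights -/

namespace RealRAM

theorem State.putI_iarr_of_ne {s : State} {a b k v : ℕ} (h : b ≠ a) :
    (s.putI a k v).iarr b = s.iarr b := by
  funext l; simp [h]

theorem State.putR_rarr_of_ne {s : State} {a b k : ℕ} {v : ℝ} (h : b ≠ a) :
    (s.putR a k v).rarr b = s.rarr b := by
  funext l; simp [h]

/-- The orientation of three disk centers. -/
def orientExp (a b c : IExp) : RExp :=
  .sub (.mul (.sub (.get 0 b) (.get 0 a)) (.sub (.get 1 c) (.get 1 a)))
    (.mul (.sub (.get 1 b) (.get 1 a)) (.sub (.get 0 c) (.get 0 a)))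

/-- Writes into the integer array `1` the disks in the counterclockwise order around the center of
disk `0`, and replaces negative weights by zero. The integer variable `3` counts the rank of the
disk in the integer variable `1`. -/
def sortProg : Prog :=
  .down 1 (.var 0)
    (.seq (.iset 3 (.sub (.lit 1) (.sub (.lit 1) (.var 1))))
    (.seq (.down 2 (.var 0)
      (.ite (.neg (.rle (orientExp (.lit 0) (.var 2) (.var 1)) (.ofInt (.lit 0))))
        (.iset 3 (.add (.var 3) (.lit 1))) .skip))
    (.seq (.iput 1 (.var 3) (.var 1))
      (.ite (.rle (.get 3 (.var 1)) (.ofInt (.lit 0))) (.rput 3 (.var 1) (.ofInt (.lit 0)))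
        .skip))))

section Sorting

variable {n : ℕ}

/-- The memory after sorting: the integer array `1` lists the disks in the order `σ`, and the real
array `3` holds the positive parts of the weights. -/
structure IsSorted (p : Fin n → Plane) (r w : Fin n → ℝ) (σ : Equiv.Perm (Fin n)) (s : State) :
    Prop where
  size : s.ivar 0 = n
  fst : ∀ i : Fin n, s.rarr 0 i = p i 0
  snd : ∀ i : Fin n, s.rarr 1 i = p i 1
  radius : ∀ i : Fin n, s.rarr 2 i = r i
  weight : ∀ i : Fin n, s.rarr 3 i = max (w i) 0
  weight_nonneg : ∀ l, 0 ≤ s.rarr 3 l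
  perm : ∀ u : Fin n, s.iarr 1 u = σ u
  value : ∀ l, s.rarr 4 l = 0
  sets : ∀ l, s.iarr 2 l = 0

theorem arrayOf_val (f : Fin n → ℝ) (i : Fin n) : arrayOf f i = f i := by
  simp [arrayOf]

theorem arrayOf_of_le (f : Fin n → ℝ) {k : ℕ} (h : n ≤ k) : arrayOf f k = 0 := by
  simp [arrayOf, not_lt.2 h]

theorem filter_le_succ {k : ℕ} (hk : k < n) (P : Fin n → Prop) [DecidablePred P] :
    (Finset.univ.filter fun b : Fin n => k ≤ b ∧ P b).card =
      (Finset.univ.filter fun b : Fin n => k + 1 ≤ b ∧ P b).card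
        + if P ⟨k, hk⟩ then 1 else 0 := by
  have heq : (Finset.univ.filter fun b : Fin n => k ≤ b ∧ P b) =
      (Finset.univ.filter fun b : Fin n => k + 1 ≤ b ∧ P b) ∪
        (if P ⟨k, hk⟩ then {⟨k, hk⟩} else ∅) := by
    ext b
    have : b = ⟨k, hk⟩ ∨ (b ≠ ⟨k, hk⟩ ∧ b.1 ≠ k) := by
      rcases eq_or_ne b ⟨k, hk⟩ with h | h
      · exact .inl h
      · exact .inr ⟨h, fun h' => h (Fin.ext h')⟩
    rcases this with rfl | ⟨h, h'⟩
    · split_ifs with hP <;> simp [hP]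
    · have e : k ≤ b.1 ↔ k + 1 ≤ b.1 := by omega
      split_ifs with hP <;> simp [h, e]
  rw [heq, Finset.card_union_of_disjoint]
  · split_ifs <;> simp
  · split_ifs <;> simp

theorem runs_sortProg {p : Fin n → Plane} {r w : Fin n → ℝ} {σ : Equiv.Perm (Fin n)} {M : ℕ}
    (hM : n + 1 ≤ M) (hσ : ∀ o a : Fin n, o.1 = 0 → (σ.symm a : ℕ) = rank p o a) :
    Runs M sortProg (inputState p r w) (6 + n * (208 + n * 108)) (IsSorted p r w σ) := by
  classical
  refine Runs.down (m := n) (t₀ := 200 + n * 108)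
    (fun k s => s.ivar 0 = n ∧ (∀ i, s.rarr 0 i = (inputState p r w).rarr 0 i) ∧
      (∀ i, s.rarr 1 i = (inputState p r w).rarr 1 i) ∧
      (∀ i, s.rarr 2 i = (inputState p r w).rarr 2 i) ∧
      (∀ i, s.rarr 3 i = if k ≤ i then max (arrayOf w i) 0 else arrayOf w i) ∧
      (∀ u : Fin n, k ≤ u → s.iarr 1 (σ.symm u) = u) ∧
      (∀ l, s.rarr 4 l = 0) ∧ (∀ l, s.iarr 2 l = 0))
    rfl (by omega) ?_ ?_ ?_ (by simp only [IExp.cost]; nlinarith)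
  · refine ⟨by simp [inputState], by simp, by simp, by simp, fun i => ?_, fun u hu => ?_,
      by simp [inputState], by simp [inputState]⟩
    · simp only [State.setI_rarr, inputState]
      split_ifs with h
      · rw [arrayOf_of_le w h]; simp
      · rfl
    · exact absurd u.2 (by omega)
  · rintro k s hk ⟨hn, h0, h1, h2, h3, h4, h5, h6⟩ -
    set i : Fin n := ⟨k, hk⟩ with hi
    set o : Fin n := ⟨0, by omega⟩ with ho
    refine Runs.seq (t₁ := 10) (t₂ := 190 + n * 108) (Runs.iset ?_ (by decide) ?_) (by omega)
    · simp only [IExp.eval]; omega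
    refine Runs.seq (t₁ := 6 + n * 108) (t₂ := 100) ?_ (by omega)
    refine Runs.down (m := n) (t₀ := 100)
      (fun q s' => s'.ivar 0 = n ∧ s'.ivar 1 = k ∧ s'.rarr = s.rarr ∧ s'.iarr = s.iarr ∧
        s'.ivar 3 = (if i = o then 0 else 1) +
          (Finset.univ.filter fun b : Fin n => q ≤ b ∧ 0 < orient (p o) (p b) (p i)).card)
      (by simp [IExp.eval, hn]) (by omega) ?_ ?_ ?_ (by simp only [IExp.cost]; omega)
    · refine ⟨by simp [hn], by simp, by simp, by simp, ?_⟩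
      have : (Finset.univ.filter fun b : Fin n =>
          n ≤ b ∧ 0 < orient (p o) (p b) (p i)) = ∅ := by
        refine Finset.filter_eq_empty_iff.2 fun b _ h => ?_
        have := b.2
        omega
      rw [this]
      have hio : i = o ↔ k = 0 := by simp [hi, ho]
      rcases eq_or_ne k 0 with hk0 | hk0
      · simp [IExp.eval, hio, hk0]
      · simp only [State.setI_ivar, IExp.eval, hio, hk0]
        simp
        omega
    · rintro q s' hq ⟨g0, g1, g2, g3, g4⟩ -
      have hor : (orientExp (.lit 0) (.var 2) (.var 1)).eval (s'.setI 2 q) =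
          orient (p o) (p ⟨q, hq⟩) (p i) := by
        have e (f : Fin n → ℝ) (m : ℕ) (hm : m < n) : arrayOf f m = f ⟨m, hm⟩ := by
          simp [arrayOf, hm]
        simp only [orientExp, RExp.eval, IExp.eval, State.setI_rarr, State.setI_ivar, g2, h0, h1,
          g1, inputState, if_true, orient]
        simp [e _ q hq, e _ k hk, e _ 0 (by omega), hi, ho]
      refine Runs.ite (t₀ := 10) (fun hb => ?_) (fun hb => ?_) (by decide)
      · have hpos : 0 < orient (p o) (p ⟨q, hq⟩) (p i) := by
          simpa [Test.holds, hor, RExp.eval, IExp.eval] using hb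
        have hcard : (if i = o then 0 else 1) + (Finset.univ.filter fun b : Fin n =>
            q + 1 ≤ b ∧ 0 < orient (p o) (p b) (p i)).card + 1 ≤ n + 1 := by
          have := rank_lt (p := p) o i
          rw [rank_eq] at this
          have hsub := Finset.card_le_card (Finset.monotone_filter_right
            (Finset.univ : Finset (Fin n))
            (p := fun b : Fin n => q + 1 ≤ b ∧ 0 < orient (p o) (p b) (p i))
            (q := fun b : Fin n => 0 < orient (p o) (p b) (p i)) fun b _ h => h.2)
          omega
        refine Runs.iset ?_ (by decide) ⟨⟨by simp [g0], by simp [g1], by simp [g2],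
          by simp [g3], ?_⟩, by simp⟩
        · simp only [IExp.eval, State.setI_ivar]
          simp only [Nat.reduceEqDiff, if_false, g4]
          omega
        · rw [filter_le_succ hq, if_pos hpos]
          simp [IExp.eval, g4, add_assoc]
      · have hneg : ¬ 0 < orient (p o) (p ⟨q, hq⟩) (p i) := by
          simpa [Test.holds, hor, RExp.eval, IExp.eval] using hb
        refine Runs.skip (by decide) ⟨⟨by simp [g0], by simp [g1], by simp [g2],
          by simp [g3], ?_⟩, by simp⟩
        rw [filter_le_succ hq, if_neg hneg]
        simp [g4]
    · rintro s' ⟨g0, g1, g2, g3, g4⟩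
      have hrank : s'.ivar 3 = σ.symm i := by
        rw [g4, hσ o i rfl, rank_eq]
        simp
      refine Runs.seq (t₁ := 10) (t₂ := 20) (Runs.iput ?_ (by decide) ?_) (by omega)
      · simp only [IExp.eval, g1]; omega
      simp only [IExp.eval, g1, hrank]
      have hperm : ∀ u : Fin n, k ≤ u →
          (s'.putI 1 (σ.symm i) k).iarr 1 (σ.symm u) = u := by
        intro u hu
        rw [State.putI_iarr]
        split_ifs with h
        · have : u = i := σ.symm.injective (Fin.ext h.2)
          rw [this]
        · have : u ≠ i := fun h' => h ⟨rfl, by rw [h']⟩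
          have : u.1 ≠ k := fun h' => this (Fin.ext h')
          rw [g3]
          exact h4 u (by omega)
      have hwk : arrayOf w k = s.rarr 3 k := by rw [h3, if_neg (by omega)]
      refine Runs.ite (t₀ := 10) (fun hb => ?_) (fun hb => ?_) (by decide)
      · have hneg : arrayOf w k ≤ 0 := by
          rw [hwk]; simpa [Test.holds, RExp.eval, IExp.eval, g1, g2] using hb
        refine Runs.rput (by decide) ⟨⟨by simp [g0], by simp [g2, h0], by simp [g2, h1],
          by simp [g2, h2], fun l => ?_, fun u hu => ?_, by simp [g2, h5], by simp [g3, h6]⟩, by simp [g1]⟩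
        · simp only [IExp.eval, State.putI_ivar, g1, State.putR_rarr, State.putI_rarr, true_and,
            RExp.eval, g2, h3]
          rcases eq_or_ne l k with rfl | hl
          · simp [hneg]
          · have : k ≤ l ↔ k + 1 ≤ l := by omega
            simp [hl, this]
        · exact hperm u hu
      · have hpos : 0 < arrayOf w k := by
          rw [hwk]; simpa [Test.holds, RExp.eval, IExp.eval, g1, g2] using hb
        refine Runs.skip (by decide) ⟨⟨by simp [g0], by simp [g2, h0], by simp [g2, h1],
          by simp [g2, h2], fun l => ?_, fun u hu => ?_, by simp [g2, h5], by simp [g3, h6]⟩, by simp [g1]⟩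
        · simp only [State.putI_rarr, g2, h3]
          rcases eq_or_ne l k with rfl | hl
          · simp [hpos.le]
          · have : k ≤ l ↔ k + 1 ≤ l := by omega
            simp [this]
        · exact hperm u hu
  · rintro s ⟨hn, h0, h1, h2, h3, h4, h5, h6⟩
    refine ⟨hn, fun i => ?_, fun i => ?_, fun i => ?_, fun i => ?_, fun l => ?_, fun u => ?_,
      h5, h6⟩
    · rw [h0]; exact arrayOf_val (fun i => p i 0) i
    · rw [h1]; exact arrayOf_val (fun i => p i 1) i
    · rw [h2]; exact arrayOf_val _ i
    · rw [h3, if_pos (Nat.zero_le _), arrayOf_val]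
    · rw [h3, if_pos (Nat.zero_le _)]; exact le_max_right _ _
    · have := h4 (σ u) (Nat.zero_le _)
      rwa [Equiv.symm_apply_apply] at this

end Sorting

end RealRAM

/-! ### The dynamic program -/

namespace RealRAM

/-- The number of the table entry for the interval `i, …, j - 1` and the outer center `c`. -/
def entry (n i j c : ℕ) : ℕ := (i * (n + 1) + j) * (n + 1) + c

section Entry

variable {n i j c : ℕ}

theorem mul_add_inj {m a b a' b' : ℕ} (hb : b < m) (hb' : b' < m)
    (h : a * m + b = a' * m + b') : a = a' ∧ b = b' := by
  have h1 : (a * m + b) / m = a := by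
    rw [mul_comm, Nat.mul_add_div (by omega), Nat.div_eq_of_lt hb, add_zero]
  have h2 : (a' * m + b') / m = a' := by
    rw [mul_comm, Nat.mul_add_div (by omega), Nat.div_eq_of_lt hb', add_zero]
  have h3 : a = a' := by rw [← h1, ← h2, h]
  subst h3
  exact ⟨rfl, by omega⟩

theorem entry_inj {i' j' c' : ℕ} (hj : j ≤ n) (hc : c ≤ n) (hj' : j' ≤ n) (hc' : c' ≤ n)
    (h : entry n i j c = entry n i' j' c') : i = i' ∧ j = j' ∧ c = c' := by
  obtain ⟨h1, h2⟩ := mul_add_inj (by omega) (by omega) h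
  obtain ⟨h3, h4⟩ := mul_add_inj (by omega) (by omega) h1
  exact ⟨h3, h4, h2⟩

theorem entry_lt_entry {i' j' c' : ℕ} (hj : j ≤ n) (hc : c ≤ n) (h : i < i') :
    entry n i j c < entry n i' j' c' := by
  unfold entry
  have h1 : i * (n + 1) + j + 1 ≤ i' * (n + 1) + j' := by nlinarith
  nlinarith

theorem entry_lt (hi : i ≤ n) (hj : j ≤ n) (hc : c ≤ n) :
    entry n i j c < (n + 1) * (n + 1) * (n + 1) := by
  unfold entry
  have h1 : i * (n + 1) + j + 1 ≤ (n + 1) * (n + 1) := by nlinarith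
  nlinarith

theorem entry_succ : entry n i j c + (n + 1) * (n + 1) = entry n (i + 1) j c := by
  unfold entry; ring

theorem exists_entry_eq {m : ℕ} (hm : m < (n + 1) * (n + 1) * (n + 1)) :
    ∃ i j c, i ≤ n ∧ j ≤ n ∧ c ≤ n ∧ m = entry n i j c := by
  refine ⟨m / (n + 1) / (n + 1), m / (n + 1) % (n + 1), m % (n + 1), ?_, ?_, ?_, ?_⟩
  · rw [Nat.div_div_eq_div_mul]
    exact Nat.lt_succ_iff.1 (Nat.div_lt_of_lt_mul (by nlinarith))
  · exact Nat.lt_succ_iff.1 (Nat.mod_lt _ (by omega))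
  · exact Nat.lt_succ_iff.1 (Nat.mod_lt _ (by omega))
  · unfold entry
    rw [Nat.div_add_mod', Nat.div_add_mod']

theorem mul_add_div_eq {a b : ℕ} (hb : b ≤ n) : (a * (n + 1) + b) / (n + 1) = a := by
  rw [mul_comm, Nat.mul_add_div (by omega), Nat.div_eq_of_lt (by omega), add_zero]

theorem entry_div (hj : j ≤ n) (hc : c ≤ n) :
    entry n i j c / ((n + 1) * (n + 1)) = i := by
  rw [← Nat.div_div_eq_div_mul]
  unfold entry
  rw [mul_add_div_eq hc, mul_add_div_eq hj]

theorem entry_sub : entry n i j c - i * ((n + 1) * (n + 1)) = j * (n + 1) + c := by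
  have : entry n i j c = i * ((n + 1) * (n + 1)) + (j * (n + 1) + c) := by unfold entry; ring
  omega

end Entry

/-- The number `n + 1`. -/
def succExp : IExp := .add (.var 0) (.lit 1)

/-- The number of a table entry. -/
def entryExp (i j c : IExp) : IExp :=
  .add (.mul (.add (.mul i succExp) j) succExp) c

/-- The cell of the integer array `2` that tells whether `u` belongs to the set of an entry. -/
def cellExp (e u : IExp) : IExp := .get 2 (.add (.mul e succExp) u)

/-- `u` dominates `v`, where `u` and `v` are positions in the sorted order. -/
def nearTest (v u : IExp) : Test :=
  .rle (.add
      (.mul (.sub (.get 0 (.get 1 v)) (.get 0 (.get 1 u)))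
        (.sub (.get 0 (.get 1 v)) (.get 0 (.get 1 u))))
      (.mul (.sub (.get 1 (.get 1 v)) (.get 1 (.get 1 u)))
        (.sub (.get 1 (.get 1 v)) (.get 1 (.get 1 u)))))
    (.mul (.add (.get 2 (.get 1 v)) (.get 2 (.get 1 u)))
      (.add (.get 2 (.get 1 v)) (.get 2 (.get 1 u))))

/-- One candidate for the table entry of `i = ivar 3`, `j = ivar 4` and `c = ivar 5`: the center
`d = ivar 10` of `i`, and the end `k = ivar 11` of the part whose outer center is `d`. The
cheapest candidate found so far is recorded by its value `rvar 0`, the entries `ivar 6`, `ivar 7`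
and `ivar 8` of its parts and its center `ivar 9`. -/
def candidateProg : Prog :=
  .seq (.iset 10 (.div (.var 2) succExp))
  (.seq (.iset 11 (.sub (.var 2) (.mul (.var 10) succExp)))
  (.ite (.conj (.conj (.ile (.var 3) (.var 10)) (.conj (.ile (.add (.var 10) (.lit 1)) (.var 11))
      (.ile (.var 11) (.var 4)))) (nearTest (.var 3) (.var 10)))
    (.seq (.rset 1 (.add (.get 3 (.get 1 (.var 10)))
      (.add (.add (.get 4 (entryExp (.add (.var 3) (.lit 1)) (.var 10) (.var 10)))
        (.get 4 (entryExp (.add (.var 10) (.lit 1)) (.var 11) (.var 10))))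
        (.get 4 (entryExp (.var 11) (.var 4) (.var 5))))))
    (.ite (.rle (.var 1) (.var 0))
      (.seq (.rset 0 (.var 1))
      (.seq (.iset 6 (entryExp (.add (.var 3) (.lit 1)) (.var 10) (.var 10)))
      (.seq (.iset 7 (entryExp (.add (.var 10) (.lit 1)) (.var 11) (.var 10)))
      (.seq (.iset 8 (entryExp (.var 11) (.var 4) (.var 5)))
      (.iset 9 (.var 10))))))
      .skip))
    .skip))

/-- The search for the cheapest candidate. It starts with the choice of the outer center for `i`
if this is possible, and with the choice of `i` as a center otherwise. -/
def searchProg : Prog :=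
  .seq (.iset 6 (.add (.var 1) (.mul succExp succExp)))
  (.seq (.iset 7 (.var 6))
  (.seq (.iset 8 (.var 6))
  (.seq (.iset 9 (.var 3))
  (.seq (.rset 0 (.add (.get 3 (.get 1 (.var 3))) (.get 4 (.var 6))))
  (.seq (.ite (.conj (.ile (.add (.var 5) (.lit 1)) (.var 0)) (nearTest (.var 3) (.var 5)))
      (.seq (.iset 9 (.var 0)) (.rset 0 (.get 4 (.var 6))))
      .skip)
    (.down 2 (.mul succExp succExp) candidateProg))))))

/-- One cell of the set of the new entry: a logical disjunction, in arithmetic. -/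
def storeCellProg : Prog :=
  .iput 2 (.add (.mul (.var 1) succExp) (.var 2))
    (.sub (.lit 1) (.sub (.lit 1)
      (.add (.add (.add (cellExp (.var 6) (.var 2)) (cellExp (.var 7) (.var 2)))
        (cellExp (.var 8) (.var 2)))
        (.sub (.lit 1) (.add (.sub (.var 2) (.var 9)) (.sub (.var 9) (.var 2)))))))

/-- Fills the table: for each entry the value, in the real array `4`, and the indicator vector of
the set, in the integer array `2`. -/
def tableProg : Prog :=
  .down 1 (.mul (.mul succExp succExp) succExp)
    (.seq (.iset 3 (.div (.var 1) (.mul succExp succExp)))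
    (.seq (.iset 5 (.sub (.var 1) (.mul (.var 3) (.mul succExp succExp))))
    (.seq (.iset 4 (.div (.var 5) succExp))
    (.seq (.iset 5 (.sub (.var 5) (.mul (.var 4) succExp)))
    (.ite (.ile (.add (.var 3) (.lit 1)) (.var 4))
      (.seq searchProg
      (.seq (.rput 4 (.var 1) (.var 0))
      (.down 2 (.var 0) storeCellProg)))
      .skip)))))

/-- The disks at the positions `v` and `u` of the sorted order have distance at most the sum of
their radii. -/
def Near (s : State) (v u : ℕ) : Prop :=
  (s.rarr 0 (s.iarr 1 v) - s.rarr 0 (s.iarr 1 u)) * (s.rarr 0 (s.iarr 1 v) - s.rarr 0 (s.iarr 1 u))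
    + (s.rarr 1 (s.iarr 1 v) - s.rarr 1 (s.iarr 1 u))
      * (s.rarr 1 (s.iarr 1 v) - s.rarr 1 (s.iarr 1 u)) ≤
  (s.rarr 2 (s.iarr 1 v) + s.rarr 2 (s.iarr 1 u)) * (s.rarr 2 (s.iarr 1 v) + s.rarr 2 (s.iarr 1 u))

/-- The weight of the disk at the position `u` of the sorted order. -/
def weight (s : State) (u : ℕ) : ℝ := s.rarr 3 (s.iarr 1 u)

/-- The set stored for the table entry `e`. -/
def storedSet (n : ℕ) (s : State) (e u : ℕ) : Prop := s.iarr 2 (e * (n + 1) + u) ≠ 0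

theorem near_self (s : State) (u : ℕ) : Near s u u := by
  unfold Near
  nlinarith [mul_self_nonneg (s.rarr 2 (s.iarr 1 u) + s.rarr 2 (s.iarr 1 u))]

/-- The memory `s` differs from `s₁` at most in the scratch variables. -/
structure Agree (s₁ s : State) : Prop where
  ivar : ∀ x, x ≠ 2 → x < 6 → s.ivar x = s₁.ivar x
  rarr : s.rarr = s₁.rarr
  iarr : s.iarr = s₁.iarr

theorem Agree.refl (s : State) : Agree s s := ⟨fun _ _ _ => rfl, rfl, rfl⟩

theorem Agree.setI {s₁ s : State} (h : Agree s₁ s) {x v : ℕ} (hx : x = 2 ∨ 6 ≤ x) :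
    Agree s₁ (s.setI x v) :=
  ⟨fun y hy hy' => by
    rw [State.setI_ivar, if_neg (by omega)]
    exact h.ivar y hy hy', h.rarr, h.iarr⟩

theorem Agree.setR {s₁ s : State} (h : Agree s₁ s) {x : ℕ} {v : ℝ} : Agree s₁ (s.setR x v) :=
  ⟨h.ivar, h.rarr, h.iarr⟩

/-- The best candidate recorded in the scratch variables of `s`: it is a cover, and its parts are
entries beyond `m`. -/
structure IsCandidate (n : ℕ) (s₁ s : State) (m i j c : ℕ) : Prop where
  left : m < s.ivar 6
  mid : m < s.ivar 7
  right : m < s.ivar 8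
  cover : IsCover n (Near s₁) (weight s₁) (fun u => storedSet n s₁ (s.ivar 6) u ∨
    storedSet n s₁ (s.ivar 7) u ∨ storedSet n s₁ (s.ivar 8) u ∨ u = s.ivar 9) i j c (s.rvar 0)

section Search

variable {n i j c M : ℕ} {s₁ : State}

theorem eval_entryExp {s : State} {a b d : IExp} (h : s.ivar 0 = n) :
    (entryExp a b d).eval s = entry n (a.eval s) (b.eval s) (d.eval s) := by
  simp [entryExp, succExp, IExp.eval, h, entry]

theorem runs_candidateProg {q : ℕ} {s : State} {d k : ℕ}
    (hM : (n + 1) * (n + 1) * (n + 1) ≤ M)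
    (h0 : s₁.ivar 0 = n) (h3 : s₁.ivar 3 = i) (h4 : s₁.ivar 4 = j)
    (h5 : s₁.ivar 5 = c) (hj : j ≤ n) (hc : c ≤ n)
    (hW : ∀ u, 0 ≤ weight s₁ u)
    (hcov : ∀ i' j' c', i < i' → i' ≤ n → j' ≤ n → c' ≤ n →
      IsCover n (Near s₁) (weight s₁) (storedSet n s₁ (entry n i' j' c')) i' j' c'
        (s₁.rarr 4 (entry n i' j' c')))
    (hd : d ≤ n) (hk : k ≤ n) (hq : q = d * (n + 1) + k)
    (hs : Agree s₁ s) (hsq : s.ivar 2 = q)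
    (hcand : IsCandidate n s₁ s (entry n i j c) i j c) :
    Runs M candidateProg s 400 fun s' => Agree s₁ s' ∧ s'.ivar 2 = q ∧
      IsCandidate n s₁ s' (entry n i j c) i j c ∧ s'.rvar 0 ≤ s.rvar 0 ∧
      (i ≤ d → d < k → k ≤ j → Near s₁ i d → s'.rvar 0 ≤ weight s₁ d +
        (s₁.rarr 4 (entry n (i + 1) d d) + s₁.rarr 4 (entry n (d + 1) k d)
          + s₁.rarr 4 (entry n k j c))) := by
  have hbig : n + 1 ≤ (n + 1) * (n + 1) * (n + 1) := by nlinarith [Nat.zero_le n]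
  have g0 := hs.ivar 0 (by decide) (by decide)
  have g3 := hs.ivar 3 (by decide) (by decide)
  have g4 := hs.ivar 4 (by decide) (by decide)
  have g5 := hs.ivar 5 (by decide) (by decide)
  rw [h0] at g0; rw [h3] at g3; rw [h4] at g4; rw [h5] at g5
  have ed : (IExp.div (.var 2) succExp).eval s = d := by
    simp only [IExp.eval, succExp, g0, hsq, hq]
    exact mul_add_div_eq hk
  refine Runs.seq (t₁ := 20) (t₂ := 380) (Runs.iset (by omega) (by decide) ?_) (by omega)
  rw [ed]
  have ek : (IExp.sub (.var 2) (.mul (.var 10) succExp)).eval (s.setI 10 d) = k := by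
    simp [IExp.eval, succExp, g0, hsq, hq]
  refine Runs.seq (t₁ := 20) (t₂ := 360) (Runs.iset (by omega) (by decide) ?_) (by omega)
  rw [ek]
  set s2 := (s.setI 10 d).setI 11 k with hs2
  have a2 : Agree s₁ s2 := (hs.setI (by omega)).setI (by omega)
  have b0 : s2.ivar 0 = n := by simp [hs2, g0]
  have b2 : s2.ivar 2 = q := by simp [hs2, hsq]
  have b3 : s2.ivar 3 = i := by simp [hs2, g3]
  have b4 : s2.ivar 4 = j := by simp [hs2, g4]
  have b5 : s2.ivar 5 = c := by simp [hs2, g5]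
  have b10 : s2.ivar 10 = d := by simp [hs2]
  have b11 : s2.ivar 11 = k := by simp [hs2]
  have c2 : IsCandidate n s₁ s2 (entry n i j c) i j c := by
    refine ⟨?_, ?_, ?_, ?_⟩
    · simpa [hs2] using hcand.left
    · simpa [hs2] using hcand.mid
    · simpa [hs2] using hcand.right
    · simpa [hs2] using hcand.cover
  have r2 : s2.rvar = s.rvar := rfl
  clear_value s2
  have htest : (Test.conj (.conj (.ile (.var 3) (.var 10))
      (.conj (.ile (.add (.var 10) (.lit 1)) (.var 11)) (.ile (.var 11) (.var 4))))
      (nearTest (.var 3) (.var 10))).holds s2 ↔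
      (i ≤ d ∧ d < k ∧ k ≤ j) ∧ Near s₁ i d := by
    simp only [Test.holds, nearTest, RExp.eval, IExp.eval, b3, b4, b10, b11, a2.rarr, a2.iarr,
      Near, Nat.succ_le_iff]
  refine Runs.ite (t₀ := 280) (fun hb => ?_) (fun hb => ?_) (by decide)
  · obtain ⟨⟨hid, hdk, hkj⟩, hnear⟩ := htest.1 hb
    set x := weight s₁ d + (s₁.rarr 4 (entry n (i + 1) d d) + s₁.rarr 4 (entry n (d + 1) k d)
          + s₁.rarr 4 (entry n k j c)) with hx
    refine Runs.seq (t₁ := 100) (t₂ := 180) (Runs.rset (by decide) ?_) (by omega)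
    have ev : (RExp.add (.get 3 (.get 1 (.var 10)))
      (.add (.add (.get 4 (entryExp (.add (.var 3) (.lit 1)) (.var 10) (.var 10)))
        (.get 4 (entryExp (.add (.var 10) (.lit 1)) (.var 11) (.var 10))))
        (.get 4 (entryExp (.var 11) (.var 4) (.var 5))))).eval s2 = x := by
      simp only [RExp.eval, eval_entryExp b0, IExp.eval, b3, b4, b5, b10, b11, a2.rarr, a2.iarr,
        hx, weight]
    rw [ev]
    have hl : entry n i j c < entry n (i + 1) d d := entry_lt_entry hj hc (by omega)
    have hm : entry n i j c < entry n (d + 1) k d := entry_lt_entry hj hc (by omega)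
    have hr : entry n i j c < entry n k j c := entry_lt_entry hj hc (by omega)
    have hl' := entry_lt (n := n) (i := i + 1) (j := d) (c := d) (by omega) (by omega) (by omega)
    have hm' := entry_lt (n := n) (i := d + 1) (j := k) (c := d) (by omega) (by omega) (by omega)
    have hr' := entry_lt (n := n) (i := k) (j := j) (c := c) (by omega) (by omega) (by omega)
    refine Runs.ite (t₀ := 150) (fun hb => ?_) (fun hb => ?_) (by decide)
    · have hle : x ≤ s.rvar 0 := by simpa [Test.holds, RExp.eval, r2] using hb
      refine Runs.seq (t₁ := 10) (t₂ := 140) (Runs.rset (by decide) ?_) (by omega)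
      refine Runs.seq (t₁ := 30) (t₂ := 110) (Runs.iset ?_ (by decide) ?_) (by omega)
      · rw [eval_entryExp (n := n) (by simp [b0])]
        simp [IExp.eval, b3, b10]; omega
      rw [eval_entryExp (n := n) (by simp [b0])]
      refine Runs.seq (t₁ := 30) (t₂ := 80) (Runs.iset ?_ (by decide) ?_) (by omega)
      · rw [eval_entryExp (n := n) (by simp [b0])]
        simp [IExp.eval, b11, b10]; omega
      rw [eval_entryExp (n := n) (by simp [b0])]
      refine Runs.seq (t₁ := 30) (t₂ := 50) (Runs.iset ?_ (by decide) ?_) (by omega)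
      · rw [eval_entryExp (n := n) (by simp [b0])]
        simp [IExp.eval, b11, b4, b5]; omega
      rw [eval_entryExp (n := n) (by simp [b0])]
      refine Runs.iset ?_ (by decide) ?_
      · simp [IExp.eval, b10]; omega
      refine ⟨?_, ?_, ⟨?_, ?_, ?_, ?_⟩, ?_, fun _ _ _ _ => ?_⟩
      · exact ((((a2.setR.setR.setI (by omega)).setI (by omega)).setI (by omega)).setI (by omega))
      · simp [b2]
      · simpa [IExp.eval, b3, b10] using hl
      · simpa [IExp.eval, b11, b10] using hm
      · simpa [IExp.eval, b11, b4, b5] using hr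
      · have := IsCover.combine (N := Near s₁) hW hid hdk (by omega) hnear (near_self s₁ d)
          (hcov (i + 1) d d (by omega) (by omega) hd hd)
          (hcov (d + 1) k d (by omega) (by omega) hk hd)
          (hcov k j c (by omega) (by omega) hj hc)
        simpa [IExp.eval, RExp.eval, b3, b4, b5, b10, b11] using this
      · simpa [RExp.eval] using hle
      · simp [RExp.eval]
    · have hlt : s.rvar 0 < x := by simpa [Test.holds, RExp.eval, r2] using hb
      refine Runs.skip (by decide) ⟨a2.setR, by simp [b2], ⟨?_, ?_, ?_, ?_⟩, ?_,
        fun _ _ _ _ => ?_⟩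
      · simpa using c2.left
      · simpa using c2.mid
      · simpa using c2.right
      · simpa using c2.cover
      · simp [r2]
      · simpa [r2] using hlt.le
  · refine Runs.skip (by decide) ⟨a2, b2, c2, by rw [r2], fun h h' h'' h3 => ?_⟩
    exact absurd (htest.2 ⟨⟨h, h', h''⟩, h3⟩) hb

theorem runs_searchProg (hM : (n + 1) * (n + 1) * (n + 1) ≤ M)
    (h0 : s₁.ivar 0 = n) (h1 : s₁.ivar 1 = entry n i j c) (h3 : s₁.ivar 3 = i)
    (h4 : s₁.ivar 4 = j) (h5 : s₁.ivar 5 = c) (hij : i < j) (hj : j ≤ n) (hc : c ≤ n)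
    (hW : ∀ u, 0 ≤ weight s₁ u)
    (hcov : ∀ i' j' c', i < i' → i' ≤ n → j' ≤ n → c' ≤ n →
      IsCover n (Near s₁) (weight s₁) (storedSet n s₁ (entry n i' j' c')) i' j' c'
        (s₁.rarr 4 (entry n i' j' c'))) :
    Runs M searchProg s₁ (400 + (n + 1) * (n + 1) * 408) fun s' => Agree s₁ s' ∧
      IsCandidate n s₁ s' (entry n i j c) i j c ∧
      (c < n → Near s₁ i c → s'.rvar 0 ≤ s₁.rarr 4 (entry n (i + 1) j c)) ∧
      ∀ d k, i ≤ d → d < k → k ≤ j → Near s₁ i d → s'.rvar 0 ≤ weight s₁ d +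
        (s₁.rarr 4 (entry n (i + 1) d d) + s₁.rarr 4 (entry n (d + 1) k d)
          + s₁.rarr 4 (entry n k j c)) := by
  have hbig : (n + 1) * (n + 1) ≤ (n + 1) * (n + 1) * (n + 1) := by nlinarith [Nat.zero_le n]
  have hbig' : n + 1 ≤ (n + 1) * (n + 1) := by nlinarith [Nat.zero_le n]
  have hlt : entry n i j c < entry n (i + 1) j c := entry_lt_entry hj hc (by omega)
  have hlt' := entry_lt (n := n) (i := i + 1) (j := j) (c := c) (by omega) hj hc
  have hcov' := hcov (i + 1) j c (by omega) (by omega) hj hc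
  have e6 : (IExp.add (.var 1) (.mul succExp succExp)).eval s₁ = entry n (i + 1) j c := by
    simp only [IExp.eval, succExp, h0, h1]
    exact entry_succ
  unfold searchProg
  refine Runs.seq (t₁ := 20) (t₂ := 380 + (n + 1) * (n + 1) * 408)
    (Runs.iset (by omega) (by decide) ?_) (by omega)
  rw [e6]
  refine Runs.seq (t₁ := 20) (t₂ := 360 + (n + 1) * (n + 1) * 408)
    (Runs.iset (by simp [IExp.eval]; omega) (by decide) ?_) (by omega)
  refine Runs.seq (t₁ := 20) (t₂ := 340 + (n + 1) * (n + 1) * 408)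
    (Runs.iset (by simp [IExp.eval]; omega) (by decide) ?_) (by omega)
  refine Runs.seq (t₁ := 20) (t₂ := 320 + (n + 1) * (n + 1) * 408)
    (Runs.iset (by simp [IExp.eval, h3]; omega) (by decide) ?_) (by omega)
  refine Runs.seq (t₁ := 20) (t₂ := 300 + (n + 1) * (n + 1) * 408)
    (Runs.rset (by decide) ?_) (by omega)
  refine Runs.seq (t₁ := 200) (t₂ := 100 + (n + 1) * (n + 1) * 408) ?_ (by omega)
  refine Runs.mono (t₀ := 200) (Q₀ := fun s' => Agree s₁ s' ∧
      IsCandidate n s₁ s' (entry n i j c) i j c ∧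
      (c < n → Near s₁ i c → s'.rvar 0 ≤ s₁.rarr 4 (entry n (i + 1) j c))) ?_ le_rfl ?_
  · simp only [IExp.eval, State.setI_ivar, if_true, Nat.reduceEqDiff, if_false, h3, RExp.eval,
      State.setI_rarr, State.setI_iarr]
    set s2 := (((((s₁.setI 6 (entry n (i + 1) j c)).setI 7 (entry n (i + 1) j c)).setI 8
      (entry n (i + 1) j c)).setI 9 i).setR 0
        (s₁.rarr 3 (s₁.iarr 1 i) + s₁.rarr 4 (entry n (i + 1) j c))) with hs2
    have a2 : Agree s₁ s2 :=
      (((((Agree.refl s₁).setI (by omega)).setI (by omega)).setI (by omega)).setI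
        (by omega)).setR
    have htest : (Test.conj (.ile (.add (.var 5) (.lit 1)) (.var 0))
        (nearTest (.var 3) (.var 5))).holds s2 ↔ c < n ∧ Near s₁ i c := by
      have b0 : s2.ivar 0 = n := by simp [hs2, h0]
      have b3 : s2.ivar 3 = i := by simp [hs2, h3]
      have b5 : s2.ivar 5 = c := by simp [hs2, h5]
      simp only [Test.holds, nearTest, RExp.eval, IExp.eval, b0, b3, b5, a2.rarr, a2.iarr,
        Near, Nat.succ_le_iff]
    refine Runs.ite (t₀ := 20) (fun hb => ?_) (fun hb => ?_) (by decide)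
    · obtain ⟨hcn, hnear⟩ := htest.1 hb
      refine Runs.seq (t₁ := 10) (t₂ := 10) (Runs.iset ?_ (by decide) ?_) (by omega)
      · simp [IExp.eval, hs2, h0]; omega
      refine Runs.rset (by decide) ⟨(a2.setI (by omega)).setR, ⟨?_, ?_, ?_, ?_⟩, fun _ _ => ?_⟩
      · simpa [hs2] using hlt
      · simpa [hs2] using hlt
      · simpa [hs2] using hlt
      · have := IsCover.outer (N := Near s₁) hcn hnear hcov'
        simpa [hs2, IExp.eval, RExp.eval, h0] using this
      · simp [hs2, IExp.eval, RExp.eval]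
    · refine Runs.skip (by decide) ⟨a2, ⟨?_, ?_, ?_, ?_⟩, fun h h' => ?_⟩
      · simpa [hs2] using hlt
      · simpa [hs2] using hlt
      · simpa [hs2] using hlt
      · have := IsCover.self (N := Near s₁) hW (by omega) (near_self s₁ i) hcov'
        simpa [hs2, weight] using this
      · exact absurd (htest.2 ⟨h, h'⟩) hb
  · rintro s2 ⟨a2, c2, l2⟩
    refine Runs.down (m := (n + 1) * (n + 1)) (t₀ := 400)
      (fun q s' => Agree s₁ s' ∧ IsCandidate n s₁ s' (entry n i j c) i j c ∧
        s'.rvar 0 ≤ s2.rvar 0 ∧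
        ∀ d k, q ≤ d * (n + 1) + k → i ≤ d → d < k → k ≤ j → Near s₁ i d →
          s'.rvar 0 ≤ weight s₁ d + (s₁.rarr 4 (entry n (i + 1) d d)
            + s₁.rarr 4 (entry n (d + 1) k d) + s₁.rarr 4 (entry n k j c)))
      ?_ (by omega) ?_ ?_ ?_ (by simp only [IExp.cost, succExp]; omega)
    · have := a2.ivar 0 (by decide) (by decide)
      simp [IExp.eval, succExp, this, h0]
    · refine ⟨a2.setI (by omega), ⟨?_, ?_, ?_, ?_⟩, by simp, fun d k hq _ hdk hkj _ => ?_⟩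
      · simpa using c2.left
      · simpa using c2.mid
      · simpa using c2.right
      · simpa using c2.cover
      · exfalso; nlinarith
    · rintro q s hq ⟨hs, hcand, hle, hlow⟩ -
      have hd : q / (n + 1) ≤ n := Nat.lt_succ_iff.1 (Nat.div_lt_of_lt_mul hq)
      have hk : q % (n + 1) ≤ n := Nat.lt_succ_iff.1 (Nat.mod_lt _ (by omega))
      have hqe : q = q / (n + 1) * (n + 1) + q % (n + 1) := (Nat.div_add_mod' q (n + 1)).symm
      have hcand' : IsCandidate n s₁ (s.setI 2 q) (entry n i j c) i j c := by
        refine ⟨?_, ?_, ?_, ?_⟩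
        · simpa using hcand.left
        · simpa using hcand.mid
        · simpa using hcand.right
        · simpa using hcand.cover
      refine (runs_candidateProg (s := s.setI 2 q) hM h0 h3 h4 h5 hj hc hW hcov hd hk hqe
        (hs.setI (by omega)) (by simp) hcand').mono le_rfl ?_
      rintro s' ⟨k1, k2, k3, k4, k5⟩
      simp only [State.setI_rvar] at k4
      refine ⟨⟨k1, k3, k4.trans hle, fun d k hdk h6 h7 h8 h9 => ?_⟩, k2⟩
      rcases eq_or_lt_of_le hdk with h | h
      · obtain ⟨h10, h11⟩ := mul_add_inj (m := n + 1) (by omega) (by omega) (hqe.symm.trans h)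
        rw [h10, h11] at k5
        exact k5 h6 h7 h8 h9
      · exact k4.trans (hlow d k h h6 h7 h8 h9)
    · rintro s' ⟨k1, k2, k3, k4⟩
      exact ⟨k1, k2, fun h h' => k3.trans (l2 h h'), fun d k => k4 d k (Nat.zero_le _)⟩

end Search

end RealRAM

namespace RealRAM

/-- The memory `s` differs from `s₀` at most in the table and in the variables other than the
size. -/
structure SameInput (s₀ s : State) : Prop where
  size : s.ivar 0 = s₀.ivar 0
  rarr : ∀ a, a ≠ 4 → s.rarr a = s₀.rarr a
  iarr : ∀ a, a ≠ 2 → s.iarr a = s₀.iarr a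

theorem SameInput.near {s₀ s : State} (h : SameInput s₀ s) : Near s = Near s₀ := by
  funext v u
  simp only [Near, h.rarr 0 (by decide), h.rarr 1 (by decide), h.rarr 2 (by decide),
    h.iarr 1 (by decide)]

theorem SameInput.weight {s₀ s : State} (h : SameInput s₀ s) : weight s = weight s₀ := by
  funext u
  simp only [RealRAM.weight, h.rarr 3 (by decide), h.iarr 1 (by decide)]

/-- The table entry for `i`, `j` and `c` is correct. -/
def EntryCorrect (n : ℕ) (s₀ s : State) (i j c : ℕ) : Prop :=
  IsCover n (Near s₀) (weight s₀) (storedSet n s (entry n i j c)) i j c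
      (s.rarr 4 (entry n i j c)) ∧
    IsLowerBound n (Near s₀) (weight s₀) i j c (s.rarr 4 (entry n i j c))

section Table

variable {n i j c M : ℕ} {s₀ : State}

theorem EntryCorrect.congr {s s' : State} (h : EntryCorrect n s₀ s i j c)
    (hv : s'.rarr 4 (entry n i j c) = s.rarr 4 (entry n i j c))
    (hs : ∀ u < n, s'.iarr 2 (entry n i j c * (n + 1) + u)
      = s.iarr 2 (entry n i j c * (n + 1) + u)) : EntryCorrect n s₀ s' i j c := by
  refine ⟨?_, by rw [hv]; exact h.2⟩
  rw [hv]
  exact h.1.congr fun u hu => by simp [storedSet, hs u hu]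

/-- The computation of one table entry from those with a larger first index. -/
theorem runs_entry {s₁ : State} (hM : (n + 1) * (n + 1) * (n + 1) ≤ M)
    (hW : ∀ u, 0 ≤ weight s₀ u) (h0 : s₁.ivar 0 = n) (h1 : s₁.ivar 1 = entry n i j c)
    (h3 : s₁.ivar 3 = i) (h4 : s₁.ivar 4 = j) (h5 : s₁.ivar 5 = c) (hij : i < j) (hj : j ≤ n)
    (hc : c ≤ n) (hin : SameInput s₀ s₁)
    (hV : ∀ i' j' c', i < i' → i' ≤ n → j' ≤ n → c' ≤ n → EntryCorrect n s₀ s₁ i' j' c') :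
    Runs M (.seq searchProg (.seq (.rput 4 (.var 1) (.var 0)) (.down 2 (.var 0) storeCellProg))) s₁
      (600 + (n + 1) * (n + 1) * 408 + n * 108) fun s' =>
      SameInput s₀ s' ∧ s'.ivar 1 = entry n i j c ∧ EntryCorrect n s₀ s' i j c ∧
      (∀ e, e ≠ entry n i j c → s'.rarr 4 e = s₁.rarr 4 e ∧
        ∀ u ≤ n, s'.iarr 2 (e * (n + 1) + u) = s₁.iarr 2 (e * (n + 1) + u)) := by
  have hbig : n + 1 ≤ (n + 1) * (n + 1) * (n + 1) := by nlinarith [Nat.zero_le n]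
  have hN := hin.near
  have hWt := hin.weight
  refine Runs.seq (t₁ := 400 + (n + 1) * (n + 1) * 408) (t₂ := 150 + n * 108) ?_ (by omega)
  refine (runs_searchProg hM h0 h1 h3 h4 h5 hij hj hc (by rw [hWt]; exact hW)
    (fun i' j' c' a b d e => by rw [hN, hWt]; exact (hV i' j' c' a b d e).1)).mono le_rfl ?_
  rintro s2 ⟨a2, c2, l2, l3⟩
  rw [hN] at l2 l3
  rw [hWt] at l3
  have b0 : s2.ivar 0 = n := (a2.ivar 0 (by decide) (by decide)).trans h0
  have b1 : s2.ivar 1 = entry n i j c := (a2.ivar 1 (by decide) (by decide)).trans h1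
  have hlow : IsLowerBound n (Near s₀) (weight s₀) i j c (s2.rvar 0) :=
    IsLowerBound.step (V := fun i j c => s₁.rarr 4 (entry n i j c)) hij hj hc
      (fun i' j' c' a b d e => (hV i' j' c' a b d e).2) l2 l3
  have hcov := c2.cover
  rw [hN, hWt] at hcov
  set m := entry n i j c with hm
  refine Runs.seq (t₁ := 10) (t₂ := 140 + n * 108) (Runs.rput (by decide) ?_) (by omega)
  simp only [IExp.eval, RExp.eval, b1]
  refine Runs.down (m := n) (t₀ := 100)
    (fun q s' => (∀ x, x ≠ 2 → s'.ivar x = s2.ivar x) ∧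
      s'.rarr = (s2.putR 4 m (s2.rvar 0)).rarr ∧ (∀ a, a ≠ 2 → s'.iarr a = s2.iarr a) ∧
      (∀ e, e ≠ m → ∀ u ≤ n, s'.iarr 2 (e * (n + 1) + u) = s2.iarr 2 (e * (n + 1) + u)) ∧
      ∀ u < n, q ≤ u → (storedSet n s' m u ↔ storedSet n s₁ (s2.ivar 6) u ∨
        storedSet n s₁ (s2.ivar 7) u ∨ storedSet n s₁ (s2.ivar 8) u ∨ u = s2.ivar 9))
    (by simp [IExp.eval, b0]) (by omega) ?_ ?_ ?_ (by simp only [IExp.cost]; omega)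
  · exact ⟨fun x hx => by simp [hx], rfl, fun _ _ => rfl, fun _ _ _ _ => rfl,
      fun u hu hu' => by omega⟩
  · rintro q s hq ⟨k1, k2, k3, k4, k5⟩ -
    have d0 : (s.setI 2 q).ivar 0 = n := by simp [k1, b0]
    have d1 : (s.setI 2 q).ivar 1 = m := by simp [k1, b1]
    have d6 : (s.setI 2 q).ivar 6 = s2.ivar 6 := by simp [k1]
    have d7 : (s.setI 2 q).ivar 7 = s2.ivar 7 := by simp [k1]
    have d8 : (s.setI 2 q).ivar 8 = s2.ivar 8 := by simp [k1]
    have d9 : (s.setI 2 q).ivar 9 = s2.ivar 9 := by simp [k1]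
    have d2 : (s.setI 2 q).ivar 2 = q := by simp
    refine Runs.iput (by simp only [IExp.eval]; omega) (by decide) ?_
    simp only [IExp.eval, cellExp, succExp, d0, d1, d2, d6, d7, d8, d9]
    rw [State.setI_iarr, k4 _ c2.left.ne' q hq.le, k4 _ c2.mid.ne' q hq.le,
      k4 _ c2.right.ne' q hq.le, a2.iarr]
    refine ⟨⟨fun x hx => by simp [hx, k1], by simp [k2], fun a ha => ?_, fun e he u hu => ?_,
      fun u hu hu' => ?_⟩, by simp⟩
    · rw [State.putI_iarr_of_ne ha]
      exact (k3 a ha).trans (by rw [a2.iarr])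
    · rw [State.putI_iarr, if_neg]
      · exact (k4 e he u hu).trans (by rw [a2.iarr])
      · exact fun h => he (mul_add_inj (by omega) (by omega) h.2).1
    · unfold storedSet
      rw [State.putI_iarr]
      split_ifs with h
      · have : u = q := by omega
        subst this
        -- The stored word is `1` exactly when one of the four summands is nonzero.
        omega
      · have : u ≠ q := fun h' => h ⟨rfl, by rw [h']⟩
        exact k5 u hu (by omega)
  · rintro s' ⟨k1, k2, k3, k4, k5⟩
    have hval : s'.rarr 4 m = s2.rvar 0 := by simp [k2]
    refine ⟨⟨?_, fun a ha => ?_, fun a ha => ?_⟩, ?_, ⟨?_, ?_⟩, fun e he => ⟨?_, fun u hu => ?_⟩⟩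
    · rw [k1 0 (by decide), b0, ← h0, hin.size]
    · rw [k2, State.putR_rarr_of_ne ha, a2.rarr, hin.rarr a ha]
    · rw [k3 a ha, a2.iarr, hin.iarr a ha]
    · rw [k1 1 (by decide), b1]
    · rw [← hm, hval]
      exact hcov.congr fun u hu => k5 u hu (Nat.zero_le _)
    · rw [← hm, hval]
      exact hlow
    · rw [k2, State.putR_rarr, if_neg (fun h => he h.2), a2.rarr]
    · rw [k4 e he u hu, a2.iarr]

theorem runs_tableProg {s : State} (hM : (n + 1) * (n + 1) * (n + 1) ≤ M)
    (hn : s.ivar 0 = n) (hW : ∀ u, 0 ≤ weight s u)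
    (hv : ∀ l, s.rarr 4 l = 0) (hs : ∀ l, s.iarr 2 l = 0) :
    Runs M tableProg s
      (30 + (n + 1) * (n + 1) * (n + 1) * (708 + (n + 1) * (n + 1) * 408 + n * 108))
      fun s' => SameInput s s' ∧ EntryCorrect n s s' 0 n n := by
  refine Runs.down (m := (n + 1) * (n + 1) * (n + 1))
    (t₀ := 700 + (n + 1) * (n + 1) * 408 + n * 108)
    (fun k s' => SameInput s s' ∧
      (∀ i j c, i ≤ n → j ≤ n → c ≤ n → k ≤ entry n i j c → EntryCorrect n s s' i j c) ∧
      ∀ e < k, s'.rarr 4 e = 0 ∧ ∀ u ≤ n, s'.iarr 2 (e * (n + 1) + u) = 0)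
    ?_ hM ?_ ?_ ?_ ?_
  · simp [IExp.eval, succExp, hn]
  · refine ⟨⟨by simp, by simp, by simp⟩, fun i j c hi hj hc h => ?_, by simp [hv, hs]⟩
    exact absurd (entry_lt hi hj hc) (by omega)
  · rintro m t hm ⟨hin, hok, hz⟩ -
    obtain ⟨i, j, c, hi, hj, hc, hmeq⟩ := exists_entry_eq hm
    have h0 : t.ivar 0 = n := hin.size.trans hn
    have e1 : (IExp.div (.var 1) (.mul succExp succExp)).eval (t.setI 1 m) = i := by
      simp only [IExp.eval, succExp, State.setI_ivar, if_true, h0, hmeq]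
      exact entry_div hj hc
    have hle : j * (n + 1) + c ≤ m := by
      rw [hmeq]; unfold entry; nlinarith [Nat.zero_le (i * (n + 1) * (n + 1))]
    have hbig : n + 1 ≤ (n + 1) * (n + 1) * (n + 1) := by nlinarith [Nat.zero_le n]
    refine Runs.seq (t₁ := 20) (t₂ := 680 + (n + 1) * (n + 1) * 408 + n * 108)
      (Runs.iset (by omega) (by decide) ?_) (by omega)
    rw [e1]
    have e2 : (IExp.sub (.var 1) (.mul (.var 3) (.mul succExp succExp))).eval
        ((t.setI 1 m).setI 3 i) = j * (n + 1) + c := by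
      simp only [IExp.eval, succExp, State.setI_ivar]
      simp only [Nat.reduceEqDiff, if_true, if_false, h0, hmeq]
      exact entry_sub
    refine Runs.seq (t₁ := 20) (t₂ := 660 + (n + 1) * (n + 1) * 408 + n * 108)
      (Runs.iset (by omega) (by decide) ?_) (by omega)
    rw [e2]
    have e3 : (IExp.div (.var 5) succExp).eval
        (((t.setI 1 m).setI 3 i).setI 5 (j * (n + 1) + c)) = j := by
      simp only [IExp.eval, succExp, State.setI_ivar]
      simp only [Nat.reduceEqDiff, if_true, if_false, h0]
      exact mul_add_div_eq hc
    refine Runs.seq (t₁ := 20) (t₂ := 640 + (n + 1) * (n + 1) * 408 + n * 108)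
      (Runs.iset (by omega) (by decide) ?_) (by omega)
    rw [e3]
    have e4 : (IExp.sub (.var 5) (.mul (.var 4) succExp)).eval
        ((((t.setI 1 m).setI 3 i).setI 5 (j * (n + 1) + c)).setI 4 j) = c := by
      simp [IExp.eval, succExp, h0]
    refine Runs.seq (t₁ := 20) (t₂ := 620 + (n + 1) * (n + 1) * 408 + n * 108)
      (Runs.iset (by omega) (by decide) ?_) (by omega)
    rw [e4]
    set t1 := ((((t.setI 1 m).setI 3 i).setI 5 (j * (n + 1) + c)).setI 4 j).setI 5 c with ht1
    have f0 : t1.ivar 0 = n := by simp [ht1, h0]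
    have f1 : t1.ivar 1 = m := by simp [ht1]
    have f3 : t1.ivar 3 = i := by simp [ht1]
    have f4 : t1.ivar 4 = j := by simp [ht1]
    have f5 : t1.ivar 5 = c := by simp [ht1]
    have fr : t1.rarr = t.rarr := rfl
    have fi : t1.iarr = t.iarr := rfl
    have hin1 : SameInput s t1 :=
      ⟨by rw [f0, hn], fun a ha => by rw [fr, hin.rarr a ha], fun a ha => by rw [fi, hin.iarr a ha]⟩
    clear_value t1
    have hother : ∀ i' j' c', j' ≤ n → c' ≤ n → m ≤ entry n i' j' c' →
        (i' = i ∧ j' = j ∧ c' = c) ∨ m + 1 ≤ entry n i' j' c' ∧ entry n i' j' c' ≠ m := by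
      intro i' j' c' hj' hc' hle
      rcases eq_or_lt_of_le hle with h | h
      · obtain ⟨rfl, rfl, rfl⟩ := entry_inj hj hc hj' hc' (hmeq.symm.trans h)
        exact .inl ⟨rfl, rfl, rfl⟩
      · exact .inr ⟨h, h.ne'⟩
    refine Runs.ite (t₀ := 600 + (n + 1) * (n + 1) * 408 + n * 108) (fun hb => ?_) (fun hb => ?_)
      (by have : (Test.ile (.add (.var 3) (.lit 1)) (.var 4)).cost = 5 := rfl
          omega)
    · have hij : i < j := by simpa [Test.holds, IExp.eval, f3, f4, Nat.succ_le_iff] using hb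
      refine (runs_entry hM hW f0 (f1.trans hmeq) f3 f4 f5 hij hj hc hin1
        fun i' j' c' a b d e => ?_).mono le_rfl ?_
      · have := entry_lt_entry (i' := i') (j' := j') (c' := c') hj hc a
        exact (hok i' j' c' b d e (by omega)).congr (by rw [fr]) (by simp [fi])
      · rintro s' ⟨k1, k2, k3, k4⟩
        refine ⟨⟨k1, fun i' j' c' a b d e => ?_, fun e he => ?_⟩, k2.trans hmeq.symm⟩
        · rcases hother i' j' c' b d e with ⟨rfl, rfl, rfl⟩ | ⟨h, hne⟩
          · exact k3
          · rw [hmeq] at hne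
            refine (hok i' j' c' a b d h).congr (by rw [(k4 _ hne).1, fr]) fun u hu => ?_
            rw [(k4 _ hne).2 u hu.le, fi]
        · have hne : e ≠ entry n i j c := by omega
          refine ⟨by rw [(k4 e hne).1, fr]; exact (hz e (by omega)).1, fun u hu => ?_⟩
          rw [(k4 e hne).2 u hu, fi]
          exact (hz e (by omega)).2 u hu
    · have hji : j ≤ i := by simpa [Test.holds, IExp.eval, f3, f4] using hb
      refine Runs.skip (by omega) ⟨⟨hin1, fun i' j' c' a b d e => ?_, fun e he => ?_⟩, f1⟩
      · rcases hother i' j' c' b d e with ⟨rfl, rfl, rfl⟩ | ⟨h, hne⟩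
        · have hz' := hz m (by omega)
          rw [hmeq, ← fr, ← fi] at hz'
          unfold EntryCorrect
          rw [hz'.1]
          exact ⟨.of_le hji fun u hu => by simp [storedSet, hz'.2 u hu.le], .of_le hji⟩
        · exact (hok i' j' c' a b d h).congr (by rw [fr]) (by simp [fi])
      · rw [fr, fi]
        exact hz e (by omega)
  · rintro s' ⟨k1, k2, -⟩
    exact ⟨k1, k2 0 n n (Nat.zero_le _) le_rfl le_rfl (Nat.zero_le _)⟩
  · have : (IExp.mul (.mul succExp succExp) succExp).cost = 11 := rfl
    rw [this]
    have : 8 + (700 + (n + 1) * (n + 1) * 408 + n * 108)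
      = 708 + (n + 1) * (n + 1) * 408 + n * 108 := by ring
    rw [this]
    omega

end Table

/-! ### The output -/

/-- Writes the output: the set of the last table entry, together with all disks of clamped
weight zero. -/
def outputProg : Prog :=
  .down 1 (.var 0)
    (.ite (.rle (.get 3 (.get 1 (.var 1))) (.ofInt (.lit 0)))
      (.iput 0 (.get 1 (.var 1)) (.lit 1))
      (.iput 0 (.get 1 (.var 1)) (.sub (.lit 1) (.sub (.lit 1)
        (cellExp (entryExp (.lit 0) (.var 0) (.var 0)) (.var 1))))))

theorem runs_outputProg {n M : ℕ} {s : State} (σ : Equiv.Perm (Fin n)) (hM : n + 1 ≤ M)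
    (hn : s.ivar 0 = n) (hσ : ∀ u : Fin n, s.iarr 1 u = σ u) :
    Runs M outputProg s (6 + n * 108) fun s' => ∀ u : Fin n, σ u ∈ outputSet n s' ↔
      weight s u ≤ 0 ∨ storedSet n s (entry n 0 n n) u := by
  refine Runs.down (m := n) (t₀ := 100)
    (fun k s' => s'.ivar 0 = n ∧ s'.rarr = s.rarr ∧ (∀ a, a ≠ 0 → s'.iarr a = s.iarr a) ∧
      ∀ u : Fin n, k ≤ u → (s'.iarr 0 (σ u) ≠ 0 ↔
        weight s u ≤ 0 ∨ storedSet n s (entry n 0 n n) u))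
    (by simp [IExp.eval, hn]) (by omega) ?_ ?_ ?_ (by simp only [IExp.cost]; omega)
  · refine ⟨by simp [hn], by simp, by simp, fun u hu => absurd u.2 (by omega)⟩
  · rintro k s' hk ⟨g0, g1, g2, g3⟩ -
    have hput : ∀ v : ℕ, (v ≠ 0 ↔ weight s k ≤ 0 ∨ storedSet n s (entry n 0 n n) k) →
        ∀ u : Fin n, k ≤ u → (((s'.setI 1 k).putI 0 (σ ⟨k, hk⟩) v).iarr 0 (σ u) ≠ 0 ↔
          weight s u ≤ 0 ∨ storedSet n s (entry n 0 n n) u) := by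
      intro v hv u hu
      rw [State.putI_iarr]
      split_ifs with h
      · have : u = ⟨k, hk⟩ := σ.injective (Fin.ext h.2)
        subst this
        exact hv
      · have : u.1 ≠ k := fun h' => h ⟨rfl, by rw [show u = ⟨k, hk⟩ from Fin.ext h']⟩
        exact g3 u (by omega)
    have e1 : (IExp.get 1 (.var 1)).eval (s'.setI 1 k) = σ ⟨k, hk⟩ := by
      simp only [IExp.eval, State.setI_iarr, State.setI_ivar, if_true, g2 1 (by decide)]
      exact hσ ⟨k, hk⟩
    have hb' : (Test.rle (.get 3 (.get 1 (.var 1))) (.ofInt (.lit 0))).holds (s'.setI 1 k) ↔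
        weight s k ≤ 0 := by
      simp [Test.holds, RExp.eval, IExp.eval, g1, g2 1 (by decide), weight]
    refine Runs.ite (t₀ := 50) (fun hb => ?_) (fun hb => ?_) (by decide)
    · refine Runs.iput (by simp only [IExp.eval]; omega) (by decide) ?_
      rw [e1]
      refine ⟨⟨by simp [g0], by simp [g1], fun a ha => ?_, hput _ ?_⟩, by simp⟩
      · rw [State.putI_iarr_of_ne ha]; exact g2 a ha
      · simp [IExp.eval, hb'.1 hb]
    · refine Runs.iput (by simp only [IExp.eval]; omega) (by decide) ?_
      rw [e1]
      refine ⟨⟨by simp [g0], by simp [g1], fun a ha => ?_, hput _ ?_⟩, by simp⟩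
      · rw [State.putI_iarr_of_ne ha]; exact g2 a ha
      · have e2 : (entryExp (.lit 0) (.var 0) (.var 0)).eval (s'.setI 1 k) = entry n 0 n n := by
          rw [eval_entryExp (n := n) (by simp [g0])]
          simp [IExp.eval, g0]
        have hw : ¬ weight s k ≤ 0 := fun h => hb (hb'.2 h)
        simp only [IExp.eval, cellExp, succExp, e2, State.setI_ivar, State.setI_iarr]
        simp only [Nat.reduceEqDiff, if_true, if_false, g0, g2 2 (by decide), storedSet, hw,
          false_or]
        omega
  · rintro s' ⟨-, -, -, g3⟩ u
    simp only [outputSet, Finset.mem_filter, Finset.mem_univ, true_and]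
    exact g3 u (Nat.zero_le _)

end RealRAM

/-! ### Noncrossing assignments from dominating sets -/

section Assignment

variable {n : ℕ} {p : Fin n → Plane} {r : Fin n → ℝ}

theorem isDominatingSet_diskGraph_iff (hr : ∀ i, 0 ≤ r i) {S : Finset (Fin n)} :
    IsDominatingSet (diskGraph p r) S ↔ ∀ v, ∃ u ∈ S, dist (p v) (p u) ≤ r v + r u := by
  refine forall_congr' fun v => ⟨?_, ?_⟩
  · rintro (h | ⟨u, hu, -, h⟩)
    · exact ⟨v, h, by rw [dist_self]; linarith [hr v]⟩
    · exact ⟨u, hu, Metric.dist_le_add_of_nonempty_closedBall_inter_closedBall h⟩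
  · rintro ⟨u, hu, h⟩
    rcases eq_or_ne v u with rfl | hvu
    · exact .inl hu
    refine .inr ⟨u, hu, hvu, ?_⟩
    obtain ⟨y, hy1, hy2⟩ := exists_dist_le_le (hr v) (hr u)
      (by linarith : dist (p v) (p u) ≤ r u + r v)
    exact ⟨y, by rwa [dist_comm] at hy1, hy2⟩

/-- Every dominating set contains the image of an idempotent map that assigns each vertex to a
center of least additively weighted distance `dist (p v) (p s) - r s`. Passing to an
inclusion-minimal dominating set ensures that no disk of a center contains that of another, so
that each center is assigned to itself. -/
theorem exists_nearest_assignment (hr : ∀ i, 0 ≤ r i) {S : Finset (Fin n)}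
    (hS : IsDominatingSet (diskGraph p r) S) :
    ∃ f : Fin n → Fin n, (∀ v, f v ∈ S) ∧ (∀ v, f (f v) = f v) ∧
      (∀ v, dist (p v) (p (f v)) ≤ r v + r (f v)) ∧
      ∀ v u, dist (p v) (p (f v)) - r (f v) ≤ dist (p v) (p (f u)) - r (f u) := by
  obtain ⟨S₀, hS₀, hmin⟩ :=
    (Set.toFinite {S | IsDominatingSet (diskGraph p r) S}).exists_le_minimal hS
  have hdom := (isDominatingSet_diskGraph_iff hr).1 hmin.prop
  have hf : ∀ v, ∃ s ∈ S₀, ∀ s' ∈ S₀, dist (p v) (p s) - r s ≤ dist (p v) (p s') - r s' := by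
    intro v
    obtain ⟨u, hu, -⟩ := hdom v
    exact S₀.exists_min_image _ ⟨u, hu⟩
  choose f hfS hfm using hf
  refine ⟨f, fun v => hS₀ (hfS v), fun v => ?_, fun v => ?_, fun v u => hfm v _ (hfS u)⟩
  · set s := f v with hs
    set s' := f s with hs'
    by_contra hne
    have hle : dist (p s) (p s') + r s ≤ r s' := by
      have := hfm s s (hfS v)
      rw [dist_self] at this
      linarith
    -- `s` would be superfluous.
    have herase : IsDominatingSet (diskGraph p r) (S₀.erase s) := by
      rw [isDominatingSet_diskGraph_iff hr]
      intro u
      obtain ⟨t, ht, hut⟩ := hdom u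
      rcases eq_or_ne t s with hts | hts
      · rw [hts] at hut
        exact ⟨s', Finset.mem_erase.2 ⟨hne, hfS _⟩,
          by linarith [dist_triangle (p u) (p s) (p s')]⟩
      · exact ⟨t, Finset.mem_erase.2 ⟨hts, ht⟩, hut⟩
    have := hmin.le_of_le herase (Finset.erase_subset _ _) (hfS v)
    exact Finset.notMem_erase _ _ this
  · obtain ⟨u, hu, huv⟩ := hdom v
    linarith [hfm v u hu]

/-- Exchanging the centers of two crossing chords would shorten the sum of the weighted
distances. -/
theorem nearest_assignment_noncrossing (hp : ConvexIndependent ℝ p) {f : Fin n → Fin n}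
    (hf : ∀ v u, dist (p v) (p (f v)) - r (f v) ≤ dist (p v) (p (f u)) - r (f u))
    {o a b c d : Fin n} (hab : rank p o a < rank p o b) (hbc : rank p o b < rank p o c)
    (hcd : rank p o c < rank p o d) (hac : f a = c ∨ f c = a) (hbd : f b = d ∨ f d = b) :
    False := by
  obtain ⟨h1, h2⟩ := dist_add_dist_lt_of_rank_lt hp hab hbc hcd
  have hab' := dist_comm (p a) (p b)
  have hac' := dist_comm (p a) (p c)
  have had' := dist_comm (p a) (p d)
  have hbc' := dist_comm (p b) (p c)
  have hbd' := dist_comm (p b) (p d)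
  have hcd' := dist_comm (p c) (p d)
  rcases hac with hac | hac <;> rcases hbd with hbd | hbd
  · have e1 := hf a b
    have e2 := hf b a
    rw [hac, hbd] at e1 e2
    linarith
  · have e1 := hf a d
    have e2 := hf d a
    rw [hac, hbd] at e1 e2
    linarith
  · have e1 := hf c b
    have e2 := hf b c
    rw [hac, hbd] at e1 e2
    linarith
  · have e1 := hf c d
    have e2 := hf d c
    rw [hac, hbd] at e1 e2
    linarith

theorem exists_perm_rank (hp : ConvexIndependent ℝ p) :
    ∃ σ : Equiv.Perm (Fin n), ∀ o a : Fin n, o.1 = 0 → (σ.symm a : ℕ) = rank p o a := by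
  rcases Nat.eq_zero_or_pos n with rfl | hn
  · exact ⟨1, fun o => o.elim0⟩
  · have hinj : Function.Injective fun a => (⟨rank p ⟨0, hn⟩ a, rank_lt _ a⟩ : Fin n) :=
      fun a b h => rank_injective hp _ (congrArg Fin.val h)
    refine ⟨(Equiv.ofBijective _ (Finite.injective_iff_bijective.1 hinj)).symm, fun o a ho => ?_⟩
    obtain rfl : o = ⟨0, hn⟩ := Fin.ext ho
    rfl

/-- In the sorted order, every dominating set gives rise to a noncrossing assignment whose centers
weigh no more. -/
theorem exists_isNoncrossing (hr : ∀ i, 0 ≤ r i) (hp : ConvexIndependent ℝ p)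
    {σ : Equiv.Perm (Fin n)} (hσ : ∀ o a : Fin n, o.1 = 0 → (σ.symm a : ℕ) = rank p o a)
    {N : ℕ → ℕ → Prop} {W : ℕ → ℝ} {w : Fin n → ℝ} (hw : ∀ i, 0 ≤ w i)
    (hN : ∀ u v : Fin n, N u v ↔ dist (p (σ u)) (p (σ v)) ≤ r (σ u) + r (σ v))
    (hW : ∀ u : Fin n, W u = w (σ u)) {S : Finset (Fin n)}
    (hS : IsDominatingSet (diskGraph p r) S) :
    ∃ F, IsNoncrossing n N F ∧
      ∑ v ∈ Finset.Ico 0 n, (if F v = v then W v else 0) ≤ ∑ v ∈ S, w v := by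
  classical
  obtain ⟨f, hfS, hff, hfd, hfm⟩ := exists_nearest_assignment hr hS
  set F : ℕ → ℕ := fun u => if h : u < n then σ.symm (f (σ ⟨u, h⟩)) else u with hF
  have hFv : ∀ u : Fin n, F u = σ.symm (f (σ u)) := fun u => by simp [hF]
  refine ⟨F, ⟨fun v hv => ?_, fun v hv => ?_, fun v hv => ?_, ?_⟩, ?_⟩
  · rw [show v = (⟨v, hv⟩ : Fin n) from rfl, hFv]
    exact Fin.is_lt _
  · rw [show v = (⟨v, hv⟩ : Fin n) from rfl, hFv, hN, Equiv.apply_symm_apply]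
    exact hfd _
  · rw [show v = (⟨v, hv⟩ : Fin n) from rfl, hFv, hFv, Equiv.apply_symm_apply, hff]
  · intro a b c d hab hbc hcd hd hac hbd
    have ho : 0 < n := by omega
    have e : ∀ u : Fin n, rank p ⟨0, ho⟩ (σ u) = u := fun u => by
      rw [← hσ ⟨0, ho⟩ (σ u) rfl, Equiv.symm_apply_apply]
    have hchord : ∀ u v : Fin n, F u = v → f (σ u) = σ v := by
      intro u v h
      rw [hFv] at h
      rw [← Fin.ext h, Equiv.apply_symm_apply]
    refine nearest_assignment_noncrossing hp hfm (o := ⟨0, ho⟩) (a := σ ⟨a, by omega⟩)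
      (b := σ ⟨b, by omega⟩) (c := σ ⟨c, by omega⟩) (d := σ ⟨d, hd⟩) ?_ ?_ ?_ ?_ ?_
    · rw [e, e]; exact hab
    · rw [e, e]; exact hbc
    · rw [e, e]; exact hcd
    · exact hac.imp (hchord ⟨a, _⟩ ⟨c, _⟩) (hchord ⟨c, _⟩ ⟨a, _⟩)
    · exact hbd.imp (hchord ⟨b, _⟩ ⟨d, _⟩) (hchord ⟨d, _⟩ ⟨b, _⟩)
  · rw [Nat.Ico_zero_eq_range, Finset.sum_range]
    calc ∑ u : Fin n, (if F u = u then W u else 0)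
        = ∑ u : Fin n, (if f (σ u) = σ u then w (σ u) else 0) := by
          refine Finset.sum_congr rfl fun u _ => ?_
          rw [hFv, hW]
          have : (σ.symm (f (σ u)) : ℕ) = u ↔ f (σ u) = σ u := by
            rw [Fin.val_inj, Equiv.symm_apply_eq]
          simp [this]
      _ = ∑ v : Fin n, (if f v = v then w v else 0) :=
          Equiv.sum_comp σ fun v => if f v = v then w v else 0
      _ = ∑ v ∈ Finset.univ.filter (fun v => f v = v), w v := (Finset.sum_filter _ _).symm
      _ ≤ ∑ v ∈ S, w v := by
          refine Finset.sum_le_sum_of_subset_of_nonneg (fun v hv => ?_) fun v _ _ => hw v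
          rw [← (Finset.mem_filter.1 hv).2]
          exact hfS v

/-- A set that is optimal for the positive parts of the weights becomes optimal for the weights
when all vertices of weight at most zero are added. -/
theorem isMinWeightDominatingSet_of_posPart {V : Type*} [Fintype V] {G : SimpleGraph V}
    {w : V → ℝ} {S : Finset V} {C : V → Prop} [DecidablePred C]
    (hS : ∀ v, v ∈ S ↔ w v ≤ 0 ∨ C v) (hdom : IsDominatingSet G S)
    (hopt : ∀ S', IsDominatingSet G S' →
      ∑ v, (if C v then max (w v) 0 else 0) ≤ ∑ v ∈ S', max (w v) 0) :
    IsMinWeightDominatingSet G w S := by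
  classical
  refine ⟨hdom, fun S' hS' => ?_⟩
  have h1 : ∑ v ∈ S, w v ≤ ∑ v, (if C v then max (w v) 0 else 0) + ∑ v, min (w v) 0 := by
    rw [← Finset.sum_add_distrib, ← Finset.sum_filter_add_sum_filter_not Finset.univ (· ∈ S),
      Finset.filter_mem_eq_inter, Finset.univ_inter]
    have e1 : ∑ v ∈ S, w v ≤ ∑ v ∈ S, ((if C v then max (w v) 0 else 0) + min (w v) 0) := by
      refine Finset.sum_le_sum fun v hv => ?_
      rcases le_or_gt (w v) 0 with h | h
      · rw [min_eq_left h]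
        have : 0 ≤ if C v then max (w v) 0 else 0 := by split_ifs <;> simp
        linarith
      · have : C v := ((hS v).1 hv).resolve_left (not_le.2 h)
        simp [this, h.le]
    have e2 : 0 ≤ ∑ v ∈ Finset.univ.filter (· ∉ S),
        ((if C v then max (w v) 0 else 0) + min (w v) 0) := by
      refine Finset.sum_nonneg fun v hv => ?_
      have hv' := (not_congr (hS v)).1 (Finset.mem_filter.1 hv).2
      push Not at hv'
      simp [hv'.1.le, hv'.2]
    linarith
  have h2 : ∑ v, min (w v) 0 ≤ ∑ v ∈ S', min (w v) 0 := by
    rw [← Finset.sum_filter_add_sum_filter_not Finset.univ (· ∈ S'),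
      Finset.filter_mem_eq_inter, Finset.univ_inter]
    have : ∑ v ∈ Finset.univ.filter (· ∉ S'), min (w v) 0 ≤ 0 :=
      Finset.sum_nonpos fun v _ => min_le_right _ _
    linarith
  have h3 : ∑ v ∈ S', max (w v) 0 + ∑ v ∈ S', min (w v) 0 = ∑ v ∈ S', w v := by
    rw [← Finset.sum_add_distrib]
    exact Finset.sum_congr rfl fun v _ => by rw [max_add_min, add_zero]
  linarith [hopt S' hS']

end Assignment

/-! ### The algorithm -/

namespace RealRAM

/-- Sorting, filling of the table, and output. -/
def dominatingSetProg : Prog := .seq sortProg (.seq tableProg outputProg)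

/-- A bound for the number of steps, phase by phase. The constants are round upper bounds for the
straight-line parts of the programs. -/
def timeBound (n : ℕ) : ℕ :=
  (6 + n * (208 + n * 108)) +
    ((30 + (n + 1) * (n + 1) * (n + 1) * (708 + (n + 1) * (n + 1) * 408 + n * 108)) +
      (6 + n * 108))

theorem timeBound_le (n : ℕ) : timeBound n ≤ 1690 * (n + 1) ^ 5 := by
  have h : ∀ k ≤ 5, (n + 1) ^ k ≤ (n + 1) ^ 5 := fun k hk =>
    Nat.pow_le_pow_right (Nat.succ_pos n) hk
  have h0 := h 0 (by decide)
  have h1 := h 1 (by decide)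
  have h2 := h 2 (by decide)
  have h3 := h 3 (by decide)
  have h4 := h 4 (by decide)
  have hle : timeBound n ≤ 42 * (n + 1) ^ 0 + 316 * (n + 1) ^ 1 + 108 * (n + 1) ^ 2
      + 708 * (n + 1) ^ 3 + 108 * (n + 1) ^ 4 + 408 * (n + 1) ^ 5 := by
    unfold timeBound
    ring_nf
    gcongr <;> norm_num
  omega

theorem timeBound_isBigO :
    (fun n : ℕ => (timeBound n : ℝ)) =O[atTop] fun n : ℕ => (n : ℝ) ^ 5 * Real.log n ^ 2 := by
  refine IsBigO.of_bound (1690 * 32) ?_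
  filter_upwards [eventually_ge_atTop 3] with n hn
  have hn' : (3 : ℝ) ≤ n := by exact_mod_cast hn
  have hlog : 1 ≤ Real.log n := by
    rw [Real.le_log_iff_exp_le (by linarith)]
    linarith [Real.exp_one_lt_d9]
  have hlog2 : 1 ≤ Real.log n ^ 2 := one_le_pow₀ hlog
  rw [Real.norm_of_nonneg (by positivity), Real.norm_of_nonneg (by positivity)]
  have h1 : (timeBound n : ℝ) ≤ 1690 * ((n : ℝ) + 1) ^ 5 := by exact_mod_cast timeBound_le n
  have h2 : ((n : ℝ) + 1) ^ 5 ≤ (2 * n) ^ 5 := by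
    gcongr
    linarith
  have h3 : (n : ℝ) ^ 5 ≤ (n : ℝ) ^ 5 * Real.log n ^ 2 :=
    le_mul_of_one_le_right (by positivity) hlog2
  calc (timeBound n : ℝ) ≤ 1690 * (2 * n) ^ 5 := h1.trans (by linarith)
    _ = 1690 * 32 * (n : ℝ) ^ 5 := by ring
    _ ≤ 1690 * 32 * ((n : ℝ) ^ 5 * Real.log n ^ 2) := by linarith

theorem IsSorted.near_iff {n : ℕ} {p : Fin n → Plane} {r w : Fin n → ℝ}
    {σ : Equiv.Perm (Fin n)} {s : State} (h : IsSorted p r w σ s) (hr : ∀ i, 0 ≤ r i)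
    (v u : Fin n) : Near s v u ↔ dist (p (σ v)) (p (σ u)) ≤ r (σ v) + r (σ u) := by
  have hs : 0 ≤ r (σ v) + r (σ u) := add_nonneg (hr _) (hr _)
  unfold Near
  rw [h.perm, h.perm, h.fst, h.fst, h.snd, h.snd, h.radius, h.radius, EuclideanSpace.dist_eq,
    Real.sqrt_le_left hs]
  simp [Real.dist_eq, sq]

theorem runs_dominatingSetProg {n M : ℕ} {p : Fin n → Plane} {r w : Fin n → ℝ}
    (hM : (n + 1) * (n + 1) * (n + 1) ≤ M) (hr : ∀ i, 0 ≤ r i) (hp : ConvexIndependent ℝ p) :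
    Runs M dominatingSetProg (inputState p r w) (timeBound n) fun s =>
      IsMinWeightDominatingSet (diskGraph p r) w (outputSet n s) := by
  classical
  obtain ⟨σ, hσ⟩ := exists_perm_rank hp
  have hM' : n + 1 ≤ M := le_trans (by nlinarith [Nat.zero_le n]) hM
  refine Runs.seq ((runs_sortProg hM' hσ).mono le_rfl fun s hs => ?_) le_rfl
  refine Runs.seq ((runs_tableProg hM hs.size (fun u => hs.weight_nonneg _) hs.value
    hs.sets).mono le_rfl ?_) le_rfl
  rintro s' ⟨hin, hcov, hlow⟩
  refine (runs_outputProg σ hM' (hin.size.trans hs.size) fun u => ?_).mono le_rfl ?_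
  · rw [hin.iarr 1 (by decide)]
    exact hs.perm u
  intro s'' hout
  rw [hin.weight] at hout
  have hwt : ∀ u : Fin n, weight s u = max (w (σ u)) 0 := fun u => by
    rw [weight, hs.perm, hs.weight]
  refine isMinWeightDominatingSet_of_posPart
    (C := fun v => storedSet n s' (entry n 0 n n) (σ.symm v)) (fun v => ?_) ?_ fun S' hS' => ?_
  · have := hout (σ.symm v)
    rwa [Equiv.apply_symm_apply, hwt, Equiv.apply_symm_apply, max_le_iff,
      and_iff_left le_rfl] at this
  · rw [isDominatingSet_diskGraph_iff hr]
    intro v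
    rcases hcov.1 (σ.symm v) (Nat.zero_le _) (Fin.is_lt _) with ⟨u, hu, hU, hvu⟩ | ⟨h, -⟩
    · refine ⟨σ ⟨u, hu⟩, (hout ⟨u, hu⟩).2 (.inr hU), ?_⟩
      have := (hs.near_iff hr (σ.symm v) ⟨u, hu⟩).1 hvu
      rwa [Equiv.apply_symm_apply] at this
    · exact absurd h (lt_irrefl n)
  · obtain ⟨F, hF, hFle⟩ := exists_isNoncrossing hr hp hσ (w := fun i => max (w i) 0)
      (fun i => le_max_right _ _) (hs.near_iff hr) hwt hS'
    refine le_trans (le_trans ?_ hcov.2) ((hlow F hF (.inr le_rfl) fun v _ hv =>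
      .inl ⟨Nat.zero_le _, hF.lt v hv⟩).trans hFle)
    rw [Finset.sum_range, ← Equiv.sum_comp σ]
    refine le_of_eq (Finset.sum_congr rfl fun u _ => ?_)
    rw [hwt, Equiv.symm_apply_apply]

end RealRAM

/-- There is one real RAM program which, for every `n` and every set of `n` weighted disks with
centers in convex position (given in any order), computes a minimum-weight dominating set of the
disk graph in `O(n ^ 5 * (log n) ^ 2)` steps, using words of `O(log n)` bits for its integers. -/
theorem mainTheorem2 :
    ∃ (A : RealRAM.Prog) (c : ℕ) (T : ℕ → ℕ),
      ((fun n : ℕ => (T n : ℝ)) =O[atTop] fun n : ℕ => (n : ℝ) ^ 5 * Real.log n ^ 2) ∧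
      ∀ (n : ℕ) (p : Fin n → Plane) (r w : Fin n → ℝ),
        (∀ i, 0 ≤ r i) → ConvexIndependent ℝ p →
        ∃ (t : ℕ) (s : RealRAM.State),
          RealRAM.Exec ((n + 2) ^ c) A (RealRAM.inputState p r w) t s ∧
          t ≤ T n ∧
          IsMinWeightDominatingSet (diskGraph p r) w (RealRAM.outputSet n s) := by
  refine ⟨RealRAM.dominatingSetProg, 3, RealRAM.timeBound, RealRAM.timeBound_isBigO,
    fun n p r w hr hp => ?_⟩
  have hM : (n + 1) * (n + 1) * (n + 1) ≤ (n + 2) ^ 3 := by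
    calc (n + 1) * (n + 1) * (n + 1) = (n + 1) ^ 3 := by ring
      _ ≤ (n + 2) ^ 3 := Nat.pow_le_pow_left (by omega) 3
  obtain ⟨t, ht, s, hs, hmin⟩ := RealRAM.runs_dominatingSetProg (w := w) hM hr hp
  exact ⟨t, s, hs, ht, hmin⟩
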